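/- Let $M$ be a von Neumann algebra with a faithful normal tracial state $\tau$. Write $S^*=\{a : a^*\in S\}$ for $S\subseteq M$. A \emph{tracial subalgebra} of $M$ is a weak* closed subalgebra $A\subseteq M$ containing the identity of $M$ for which there is a projection $\Phi$ of $A$ onto $\mathcal D=A\cap A^*$ (a linear map $\Phi:A\to\mathcal D$ that is the identity on $\mathcal D$) which is also an algebra homomorphism and satisfies $\tau\circ\Phi=\tau$ on $A$. It is a \emph{noncommutative $H^\infty$ algebra} if moreover $A+A^*$ is weak* dense in $M$. The \emph{canonical conditional expectation} of a tracial subalgebra $A$ is the unique faithful normal conditional expectation $\Psi$ of $M$ onto $A\cap A^*$ with $\tau\circ\Psi=\tau$; its restriction to $A$ is the map $\Phi$. Let $L^2(M)$ be the completion of $M$ in the norm $\|x\|_2=\tau(x^*x)^{1/2}$, let $[A]_2$ be the closure of $A$ in $L^2(M)$, and put $A_\infty=[A]_2\cap M$. Theorem. Let $A$ be a tracial subalgebra of $M$. Then $A_\infty$ is a tracial subalgebra of $M$, and its canonical conditional expectation extends that of $A$: there is exactly one faithful normal conditional expectation $\Psi$ of $M$ onto $A\cap A^*$ with $\tau\circ\Psi=\tau$;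 the same $\Psi$ is also the unique such conditional expectation of $M$ onto $A_\infty\cap A_\infty^*$; and every homomorphic $\tau$-preserving projection of $A$ onto $A\cap A^*$, and every one of $A_\infty$ onto $A_\infty\cap A_\infty^*$, is the restriction of $\Psi$. Moreover, if $A$ is a noncommutative $H^\infty$ algebra, then $A=A_\infty$. -/

import Mathlib

open scoped ComplexOrder

namespace NCHardy

universe u

variable {H : Type u} [NormedAddCommGroup H] [InnerProductSpace ℂ H] [CompleteSpace H]

/-- A von Neumann algebra is closed under multiplication by complex scalars, so that (the type of
elements of) `M` is a complex algebra. -/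
instance instSMulMemClass : SMulMemClass (VonNeumannAlgebra H) ℂ (H →L[ℂ] H) where
  smul_mem {s} c x hx := show c • x ∈ s.toStarSubalgebra from
    s.toStarSubalgebra.toSubalgebra.smul_mem hx c

/-- The von Neumann algebra `M` with the weak* (that is, ultraweak, or σ-weak) topology: the
coarsest topology that makes all the functionals `x ↦ ∑ₙ ⟪ξₙ, x ηₙ⟫` continuous, where
`∑ₙ ‖ξₙ‖² < ∞` and `∑ₙ ‖ηₙ‖² < ∞`. -/
@[reducible] noncomputable def weakStarTopology (M : VonNeumannAlgebra H) : TopologicalSpace M :=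
  ⨅ (ξ : ℕ → H) (η : ℕ → H) (_ : Summable fun n => ‖ξ n‖ ^ 2) (_ : Summable fun n => ‖η n‖ ^ 2),
    TopologicalSpace.induced
      (fun x : M => ∑' n, inner ℂ (ξ n) ((x : H →L[ℂ] H) (η n))) inferInstance

/-- Faithful normal tracial states on `M`; normal means weak* continuous. -/
structure FaithfulNormalTracialState (M : VonNeumannAlgebra H) where
  toLinearMap : M →ₗ[ℂ] ℂ
  map_one : toLinearMap 1 = 1
  nonneg : ∀ x : M, 0 ≤ toLinearMap (star x * x)
  faithful : ∀ x : M, toLinearMap (star x * x) = 0 → x = 0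
  tracial : ∀ x y : M, toLinearMap (x * y) = toLinearMap (y * x)
  normal : @Continuous M ℂ (weakStarTopology M) inferInstance toLinearMap

variable {M : VonNeumannAlgebra H}

noncomputable instance instCoeFun : CoeFun (FaithfulNormalTracialState M) (fun _ => M → ℂ) :=
  ⟨fun τ => τ.toLinearMap⟩

theorem map_star (τ : FaithfulNormalTracialState M) (x : M) : τ (star x) = star (τ x) := by
  have h0 := (Complex.nonneg_iff.mp (τ.nonneg x)).2
  have h1 := (Complex.nonneg_iff.mp (τ.nonneg (1 + x))).2
  have h2 := (Complex.nonneg_iff.mp (τ.nonneg (1 + Complex.I • x))).2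
  have e1 : star (1 + x) * (1 + x) = 1 + x + star x + star x * x := by
    simp only [star_add, star_one]; noncomm_ring
  have e2 : star (1 + Complex.I • x) * (1 + Complex.I • x)
      = 1 + Complex.I • x - Complex.I • star x + star x * x := by
    have : star (Complex.I • x) = -(Complex.I • star x) := by
      apply Subtype.ext
      change star (Complex.I • (x : H →L[ℂ] H)) = -(Complex.I • star (x : H →L[ℂ] H))
      rw [star_smul]; simp
    rw [star_add, this, star_one, add_mul, mul_add, mul_add, neg_mul, neg_mul, smul_mul_smul_comm]
    simp
    abel
  rw [e1] at h1
  rw [e2] at h2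
  simp only [map_add, map_sub, map_smul, τ.map_one, Complex.add_im, Complex.sub_im, smul_eq_mul,
    Complex.mul_im, Complex.I_re, Complex.I_im, Complex.one_im, ← h0] at h1 h2
  apply Complex.ext
  · simp; linarith
  · simp; linarith

section L2

/-- A copy of `M`, to carry the norm `‖x‖₂ = τ(x* x)^(1/2) = τ(|x|²)^(1/2)`. -/
def PreL2 (_ : FaithfulNormalTracialState M) : Type u := M

noncomputable instance instAddCommGroupPreL2 (τ : FaithfulNormalTracialState M) :
    AddCommGroup (PreL2 τ) := inferInstanceAs (AddCommGroup M)

noncomputable instance instModulePreL2 (τ : FaithfulNormalTracialState M) :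
    Module ℂ (PreL2 τ) := inferInstanceAs (Module ℂ M)

/-- The inner product `⟪x, y⟫ = τ(x* y)` on `M`. -/
@[reducible] noncomputable def preL2Core (τ : FaithfulNormalTracialState M) :
    InnerProductSpace.Core ℂ (PreL2 τ) where
  inner x y := τ (star (show M from x) * (show M from y))
  conj_inner_symm x y := by
    have h := map_star τ (star (show M from y) * (show M from x))
    rw [star_mul, star_star] at h
    rw [h]
    simp
  re_inner_nonneg x := (Complex.nonneg_iff.mp (τ.nonneg x)).1
  add_left x y z := by
    change τ (star ((show M from x) + (show M from y)) * (show M from z)) = _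
    rw [star_add, add_mul, map_add]
  smul_left x y r := by
    change τ (star (r • (show M from x)) * (show M from y)) = _
    have : star (r • (show M from x)) = star r • star (show M from x) :=
      Subtype.ext (star_smul r ((show M from x) : H →L[ℂ] H))
    rw [this, smul_mul_assoc, map_smul]
    rfl
  definite x h := τ.faithful x h

noncomputable instance instNormedAddCommGroupPreL2 (τ : FaithfulNormalTracialState M) :
    NormedAddCommGroup (PreL2 τ) := (preL2Core τ).toNormedAddCommGroup

noncomputable instance instInnerProductSpacePreL2 (τ : FaithfulNormalTracialState M) :
    InnerProductSpace ℂ (PreL2 τ) := InnerProductSpace.ofCore (preL2Core τ).toCore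

/-- The Hilbert space `L²(M, τ)`, the completion of `M` in the norm `‖·‖₂`. -/
abbrev L2 (τ : FaithfulNormalTracialState M) : Type u := UniformSpace.Completion (PreL2 τ)

/-- The canonical (injective) embedding of `M` in `L²(M, τ)`. -/
noncomputable def toL2 (τ : FaithfulNormalTracialState M) (x : M) : L2 τ :=
  UniformSpace.Completion.coe' (show PreL2 τ from x)

end L2

/-- The set `[A]₂ ∩ M`: the elements of `M` that, as elements of `L²(M, τ)`, lie in the closure of
`A` in the norm of `L²(M, τ)`. -/
def AInfty (τ : FaithfulNormalTracialState M) (A : Subalgebra ℂ M) : Set M :=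
  {x | toL2 τ x ∈ closure (toL2 τ '' (A : Set M))}

/-- The diagonal `D = A ∩ A*` of `A`. -/
noncomputable def diagonal (A : Subalgebra ℂ M) : Subalgebra ℂ M := A ⊓ star A

/-- `Φ` is a projection of `A` onto `D = A ∩ A*` that is an algebra homomorphism and satisfies
`τ ∘ Φ = τ` on `A`. -/
structure IsTracialProjection (τ : FaithfulNormalTracialState M) (A : Subalgebra ℂ M)
    (Φ : A →ₐ[ℂ] M) : Prop where
  map_mem : ∀ a : A, Φ a ∈ diagonal A
  map_eq_self : ∀ d : A, (d : M) ∈ diagonal A → Φ d = d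
  trace_eq : ∀ a : A, τ (Φ a) = τ a

/-- Tracial subalgebras of `M`: weak* closed unital subalgebras `A` that have a projection onto
`A ∩ A*` as above. (A `Subalgebra` contains the identity of `M`.) -/
structure IsTracialSubalgebra (τ : FaithfulNormalTracialState M) (A : Subalgebra ℂ M) : Prop where
  weakStar_closed : @IsClosed M (weakStarTopology M) (A : Set M)
  exists_projection : ∃ Φ : A →ₐ[ℂ] M, IsTracialProjection τ A Φ

/-- Noncommutative `H^∞` algebras: tracial subalgebras `A` such that `A + A*` is weak* dense
in `M`. -/
structure IsNoncommutativeHInfty (τ : FaithfulNormalTracialState M) (A : Subalgebra ℂ M) :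
    Prop where
  tracial : IsTracialSubalgebra τ A
  weakStar_dense : @Dense M (weakStarTopology M) {x : M | ∃ a ∈ A, ∃ b ∈ A, x = a + star b}

/-- `Ψ` is a faithful normal conditional expectation of `M` onto the diagonal `D = A ∩ A*` of `A`
with `τ ∘ Ψ = τ`: it is a linear map of `M` onto `D` that is the identity on `D`, is
positive, a `D`-bimodule map, faithful, and preserves suprema of bounded increasing nets
(normality of a positive map). The order on `M` is the usual one of operators, `x ≤ y` if `y - x` is positive. -/
structure IsCanonicalExpectation (τ : FaithfulNormalTracialState M) (A : Subalgebra ℂ M)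
    (Ψ : M →ₗ[ℂ] M) : Prop where
  map_mem : ∀ x : M, Ψ x ∈ diagonal A
  map_eq_self : ∀ d ∈ diagonal A, Ψ d = d
  map_mul_mul : ∀ d ∈ diagonal A, ∀ e ∈ diagonal A, ∀ x : M, Ψ (d * x * e) = d * Ψ x * e
  map_nonneg : ∀ x : M, 0 ≤ x → 0 ≤ Ψ x
  faithful : ∀ x : M, Ψ (star x * x) = 0 → x = 0
  normal : ∀ (S : Set M) (s : M), S.Nonempty → DirectedOn (· ≤ ·) S → IsLUB S s →
    IsLUB (Ψ '' S) (Ψ s)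
  trace_eq : ∀ x : M, τ (Ψ x) = τ x

end NCHardy

open scoped ComplexOrder
open Filter Topology

namespace NCHardy

universe u

variable {H : Type u} [NormedAddCommGroup H] [InnerProductSpace ℂ H] [CompleteSpace H]
variable {M : VonNeumannAlgebra H}

/-! On ℓ²(ℕ, H) every weak* continuous functional on M is a single vector functional ⟨ξ, · η⟩
(`exists_vecFun_eq`), and every vector of L²(M) induces a weak* continuous functional on M
(`weakStarContinuous_inner_toL2`). This reduces the theorem to Hilbert space geometry.

The expectation Ψ is the orthogonal projection of L²(M) onto the closure of D = A ∩ A*, restricted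
to M; that it takes values in D is `exists_trace_eq`. It is determined by τ(eΨ(x)) = τ(ex) for e ∈
D, which gives uniqueness and forces every homomorphic trace-preserving projection to be its
restriction. Since Ψ contracts ‖·‖₂, its multiplicativity passes from A to A_∞
(`expectation_map_mul`). For x in the diagonal of A_∞ and y = x − Ψ(x) this gives Ψ(y*y) = 0, so y =
0 and the diagonal does not grow (`diagonal_aInfty`).

For A = A_∞ (`aInfty_le`), suppose b ∈ A_∞ is not in A. Separate it by vectors with ξ ⊥ Aζ but bζ
not orthogonal to ξ, where ζ may be enlarged so that ‖x‖₂ ≤ ‖xζ‖ on M. Let A₀ = A ∩ ker Ψ, and let q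
be the part of ζ orthogonal to A₀ζ. The closure of Dq contains a trace vector w for D
(`exists_trace_vector`). It satisfies w ⊥ A₀w, so weak* density of A + A* makes it a trace vector
for all of M (`trace_vector_of_wandering`). Finiteness of M puts ζ in the closure of Mw
(`mem_closure_orbit_symm`), and density again puts it in the closure of Aw. As x ↦ xw is isometric
for ‖·‖₂, ξ ⊥ Aw gives ξ ⊥ A_∞w; but bζ lies in the closure of A_∞w, a contradiction. -/

set_option linter.unusedSectionVars false

/-! ### C*-algebra structure and order of M -/

section CStarStructure

theorem isClosed_coe (M : VonNeumannAlgebra H) : IsClosed (M : Set (H →L[ℂ] H)) := by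
  rw [← M.centralizer_centralizer]
  exact Set.isClosed_centralizer _

instance instCompleteSpace : CompleteSpace M := (isClosed_coe M).completeSpace_coe

instance instCStarRing : CStarRing M where
  norm_mul_self_le x := CStarRing.norm_mul_self_le (x : H →L[ℂ] H)

/-- The C*-algebra structure of `M`. It is only a local instance, to keep the instances of the
underlying algebra as they are. -/
@[reducible] noncomputable def cstarAlgebra (M : VonNeumannAlgebra H) : CStarAlgebra M where
  toNormedRing := inferInstance
  toStarRing := inferInstance
  toCompleteSpace := inferInstance
  toCStarRing := inferInstance
  toNormedAlgebra := inferInstance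
  toStarModule := inferInstance

end CStarStructure

attribute [local instance] cstarAlgebra

section StarOrder

/-- The order is that of operators on H; the square root of a positive element stays in M because M
is norm closed and so stable under functional calculus. -/
instance instStarOrderedRing : StarOrderedRing M := by
  refine StarOrderedRing.of_nonneg_iff' (fun {x y} h z => ?_) (fun x => ⟨fun h => ?_, ?_⟩)
  · have h' : (x : H →L[ℂ] H) ≤ y := h
    change ((z + x : M) : H →L[ℂ] H) ≤ ((z + y : M))
    simpa using h'
  · have h' : 0 ≤ (x : H →L[ℂ] H) := h
    have hc := isClosed_coe M
    refine ⟨⟨CFC.sqrt (x : H →L[ℂ] H), ?_⟩, ?_⟩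
    · rw [CFC.sqrt_eq_real_sqrt _ h', cfcₙ_eq_cfc]
      exact cfc_mem (𝕜' := ℂ) _ x.2
    · apply Subtype.ext
      change (x : H →L[ℂ] H) = star (CFC.sqrt (x : H →L[ℂ] H)) * CFC.sqrt (x : H →L[ℂ] H)
      rw [(CFC.sqrt_nonneg (x : H →L[ℂ] H)).isSelfAdjoint.star_eq, CFC.sqrt_mul_sqrt_self _ h']
  · rintro ⟨s, rfl⟩
    change (0 : H →L[ℂ] H) ≤ star (s : H →L[ℂ] H) * s
    exact star_mul_self_nonneg _

end StarOrder

/-! ### Weak* continuous functionals as vector functionals on ℓ²(ℕ, H) -/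

section Amplification

/-- The Hilbert space `ℓ²(ℕ, H)`, on which `M` acts diagonally. -/
abbrev Ampl (H : Type u) [NormedAddCommGroup H] [InnerProductSpace ℂ H] : Type u :=
  lp (fun _ : ℕ => H) 2

theorem memlp_two_iff {f : ℕ → H} : Memℓp f 2 ↔ Summable fun n => ‖f n‖ ^ 2 := by
  rw [memℓp_gen_iff (by norm_num)]
  simp

theorem Ampl.summable (ξ : Ampl H) : Summable fun n => ‖ξ n‖ ^ 2 := memlp_two_iff.1 ξ.2

theorem Ampl.norm_sq (ξ : Ampl H) : ‖ξ‖ ^ 2 = ∑' n, ‖ξ n‖ ^ 2 := by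
  have := lp.norm_rpow_eq_tsum (p := 2) (by norm_num) ξ
  simpa using this

theorem summable_norm_apply_sq (T : H →L[ℂ] H) (ξ : Ampl H) :
    Summable fun n => ‖T (ξ n)‖ ^ 2 := by
  refine Summable.of_nonneg_of_le (fun n => by positivity) (fun n => ?_)
    ((Ampl.summable ξ).mul_left (‖T‖ ^ 2))
  rw [← mul_pow]
  exact pow_le_pow_left₀ (norm_nonneg _) (T.le_opNorm _) 2

/-- The diagonal action of an operator on `ℓ²(ℕ, H)`. -/
noncomputable def ampOp (T : H →L[ℂ] H) : Ampl H →L[ℂ] Ampl H :=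
  LinearMap.mkContinuous
    { toFun := fun ξ => ⟨fun n => T (ξ n), memlp_two_iff.2 (summable_norm_apply_sq T ξ)⟩
      map_add' := fun ξ η => by ext n; exact map_add T (ξ n) (η n)
      map_smul' := fun c ξ => by ext n; simp } ‖T‖ (fun ξ => by
    refine le_of_sq_le_sq ?_ (by positivity)
    rw [mul_pow, Ampl.norm_sq, Ampl.norm_sq, ← tsum_mul_left]
    refine (summable_norm_apply_sq T ξ).tsum_le_tsum (fun n => ?_)
      ((Ampl.summable ξ).mul_left (‖T‖ ^ 2))
    rw [← mul_pow]
    exact pow_le_pow_left₀ (norm_nonneg _) (T.le_opNorm _) 2)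

@[simp] theorem ampOp_apply (T : H →L[ℂ] H) (ξ : Ampl H) (n : ℕ) : ampOp T ξ n = T (ξ n) := rfl

/-- The normal representation of `M` on `ℓ²(ℕ, H)`. -/
noncomputable def rep (M : VonNeumannAlgebra H) : M →ₐ[ℂ] (Ampl H →L[ℂ] Ampl H) where
  toFun x := ampOp (x : H →L[ℂ] H)
  map_one' := by ext ξ n; simp
  map_mul' x y := by ext ξ n; simp
  map_zero' := by ext ξ n; simp
  map_add' x y := by ext ξ n; simp
  commutes' c := by
    ext ξ n
    rw [Algebra.algebraMap_eq_smul_one, Algebra.algebraMap_eq_smul_one]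
    simp

@[simp] theorem rep_apply (x : M) (ξ : Ampl H) (n : ℕ) : rep M x ξ n = (x : H →L[ℂ] H) (ξ n) := rfl

theorem inner_rep_star_left (x : M) (ξ η : Ampl H) :
    inner ℂ (rep M (star x) ξ) η = inner ℂ ξ (rep M x η) := by
  rw [lp.inner_eq_tsum, lp.inner_eq_tsum]
  refine tsum_congr fun n => ?_
  rw [rep_apply, rep_apply]
  exact ContinuousLinearMap.adjoint_inner_left _ _ _

theorem inner_rep_left (x : M) (ξ η : Ampl H) :
    inner ℂ (rep M x ξ) η = inner ℂ ξ (rep M (star x) η) := by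
  rw [← inner_rep_star_left, star_star]

/-- The functional `x ↦ ⟪ξ, x η⟫` on `M`. -/
noncomputable def vecFun (M : VonNeumannAlgebra H) (ξ η : Ampl H) : M →ₗ[ℂ] ℂ where
  toFun x := inner ℂ ξ (rep M x η)
  map_add' x y := by simp
  map_smul' c x := by simp

theorem vecFun_apply (ξ η : Ampl H) (x : M) : vecFun M ξ η x = inner ℂ ξ (rep M x η) := rfl

theorem weakStarTopology_eq (M : VonNeumannAlgebra H) : weakStarTopology M =
    ⨅ p : Ampl H × Ampl H, TopologicalSpace.induced (vecFun M p.1 p.2) inferInstance := by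
  have key : ∀ ξ η : Ampl H, (fun x : M => ∑' n, inner ℂ (ξ n) ((x : H →L[ℂ] H) (η n)))
      = vecFun M ξ η := fun ξ η => by
    ext x
    rw [vecFun_apply, lp.inner_eq_tsum]
    rfl
  apply le_antisymm
  · refine le_iInf fun p => ?_
    rw [← key]
    exact iInf_le_of_le p.1 <| iInf_le_of_le p.2 <| iInf_le_of_le (Ampl.summable p.1) <|
      iInf_le_of_le (Ampl.summable p.2) le_rfl
  · refine le_iInf fun ξ => le_iInf fun η => le_iInf fun hξ => le_iInf fun hη => ?_
    refine iInf_le_of_le (⟨ξ, memlp_two_iff.2 hξ⟩, ⟨η, memlp_two_iff.2 hη⟩) ?_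
    rw [← key]

/-- Weak* continuity of a complex function on `M`. -/
def WeakStarContinuous (f : M → ℂ) : Prop := @Continuous M ℂ (weakStarTopology M) inferInstance f

theorem weakStarContinuous_vecFun (ξ η : Ampl H) : WeakStarContinuous (vecFun M ξ η) := by
  rw [WeakStarContinuous, weakStarTopology_eq, continuous_iff_le_induced]
  exact iInf_le_of_le (ξ, η) le_rfl

/-- Interleaving of two sequences. -/
noncomputable def interleave (a b : Ampl H) : Ampl H :=
  ⟨fun n => Sum.elim a b (Equiv.natSumNatEquivNat.symm n), by
    refine memlp_two_iff.2 ?_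
    refine (Equiv.natSumNatEquivNat.symm.summable_iff
      (f := fun i : ℕ ⊕ ℕ => ‖(Sum.elim a b i : H)‖ ^ 2)).2 ?_
    have h1 : HasSum ((fun i : ℕ ⊕ ℕ => ‖(Sum.elim a b i : H)‖ ^ 2) ∘ Sum.inl) _ :=
      (Ampl.summable a).hasSum
    have h2 : HasSum ((fun i : ℕ ⊕ ℕ => ‖(Sum.elim a b i : H)‖ ^ 2) ∘ Sum.inr) _ :=
      (Ampl.summable b).hasSum
    exact (h1.sum h2).summable⟩

theorem rep_interleave (x : M) (a b : Ampl H) :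
    rep M x (interleave a b) = interleave (rep M x a) (rep M x b) := by
  ext n
  rw [rep_apply]
  change _ = Sum.elim _ _ _
  change (x : H →L[ℂ] H) (Sum.elim _ _ _) = _
  rcases Equiv.natSumNatEquivNat.symm n with i | i <;> rfl

theorem inner_interleave (a b c d : Ampl H) :
    inner ℂ (interleave a b) (interleave c d) = inner ℂ a c + inner ℂ b d := by
  have h : HasSum (fun i : ℕ ⊕ ℕ => inner ℂ (Sum.elim a b i : H) (Sum.elim c d i))
      (inner ℂ a c + inner ℂ b d) := HasSum.sum (lp.hasSum_inner a c) (lp.hasSum_inner b d)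
  rw [lp.inner_eq_tsum]
  exact ((Equiv.natSumNatEquivNat.symm.hasSum_iff).2 h).tsum_eq

/-- Continuity for an initial topology means lying in the span of the defining functionals;
interleaving merges a sum of two vector functionals into one, so the span adds nothing. -/
theorem exists_vecFun_eq {φ : M →ₗ[ℂ] ℂ} (hφ : WeakStarContinuous φ) :
    ∃ ξ η : Ampl H, φ = vecFun M ξ η := by
  rw [WeakStarContinuous, weakStarTopology_eq, ← LinearMap.mem_span_iff_continuous
    (f := fun p : Ampl H × Ampl H => vecFun M p.1 p.2)] at hφ
  induction hφ using Submodule.span_induction with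
  | mem f hf => obtain ⟨p, rfl⟩ := hf; exact ⟨p.1, p.2, rfl⟩
  | zero => exact ⟨0, 0, by ext x; simp [vecFun_apply]⟩
  | add f g _ _ hf hg =>
    obtain ⟨a, c, rfl⟩ := hf
    obtain ⟨b, d, rfl⟩ := hg
    refine ⟨interleave a b, interleave c d, ?_⟩
    ext x
    rw [vecFun_apply, rep_interleave, inner_interleave]
    rfl
  | smul r f _ hf =>
    obtain ⟨a, c, rfl⟩ := hf
    refine ⟨a, r • c, ?_⟩
    ext x
    simp [vecFun_apply]

theorem exists_continuous_separating {E ι : Type*} [AddCommGroup E] [Module ℂ E]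
    (f : ι → E →ₗ[ℂ] ℂ) (S : Submodule ℂ E)
    (hS : @IsClosed E (⨅ i, TopologicalSpace.induced (f i) inferInstance) (S : Set E)) {b : E}
    (hb : b ∉ S) : ∃ φ : E →ₗ[ℂ] ℂ,
      @Continuous E ℂ (⨅ i, TopologicalSpace.induced (f i) inferInstance) inferInstance φ ∧
      (∀ a ∈ S, φ a = 0) ∧ φ b ≠ 0 := by
  let t : TopologicalSpace E := ⨅ i, TopologicalSpace.induced (f i) inferInstance
  have : IsTopologicalAddGroup E := topologicalAddGroup_iInf fun _ => topologicalAddGroup_induced _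
  have : ContinuousSMul ℂ E := continuousSMul_iInf fun _ => continuousSMul_induced _
  have : LocallyConvexSpace ℝ E := LocallyConvexSpace.iInf fun i =>
    LocallyConvexSpace.induced ((f i).restrictScalars ℝ)
  obtain ⟨φ, u, hu, hφ⟩ := RCLike.geometric_hahn_banach_closed_point (𝕜 := ℂ)
    (S.restrictScalars ℝ).convex hS hb
  have h0 : 0 < u := by simpa using hu 0 S.zero_mem
  refine ⟨φ.toLinearMap, φ.continuous, fun a ha => ?_, fun h => ?_⟩
  · by_contra hne
    -- The multiple of `a` at which `φ` takes the value `u` violates the strict bound.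
    have := hu (((u / (φ a) : ℂ)) • a) (S.smul_mem _ ha)
    rw [map_smul, smul_eq_mul, div_mul_cancel₀ _ (show φ a ≠ 0 from hne)] at this
    simp at this
  · have : φ b = 0 := h
    rw [this] at hφ
    simp at hφ
    linarith

theorem exists_vecFun_separating (S : Submodule ℂ M)
    (hS : @IsClosed M (weakStarTopology M) (S : Set M)) {b : M} (hb : b ∉ S) :
    ∃ ξ η : Ampl H, (∀ a ∈ S, inner ℂ ξ (rep M a η) = 0) ∧ inner ℂ ξ (rep M b η) ≠ 0 := by
  rw [weakStarTopology_eq] at hS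
  obtain ⟨φ, hφ, h1, h2⟩ := exists_continuous_separating _ S hS hb
  rw [← weakStarTopology_eq] at hφ
  obtain ⟨ξ, η, rfl⟩ := exists_vecFun_eq hφ
  exact ⟨ξ, η, h1, h2⟩

end Amplification

/-! ### The norm ‖·‖₂ and trace inequalities -/

section TraceNorm

variable (τ : FaithfulNormalTracialState M)

theorem inner_toL2 (x y : M) : inner ℂ (toL2 τ x) (toL2 τ y) = τ (star x * y) :=
  UniformSpace.Completion.inner_coe (𝕜 := ℂ) (E := PreL2 τ) x y

/-- The embedding of `M` in `L²(M, τ)` as a linear map. -/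
noncomputable def toL2Lin : M →ₗ[ℂ] L2 τ where
  toFun := toL2 τ
  map_add' x y := UniformSpace.Completion.coe_add (α := PreL2 τ) x y
  map_smul' c x := UniformSpace.Completion.coe_smul (X := PreL2 τ) c x

theorem toL2_add (x y : M) : toL2 τ (x + y) = toL2 τ x + toL2 τ y := map_add (toL2Lin τ) x y

theorem toL2_sub (x y : M) : toL2 τ (x - y) = toL2 τ x - toL2 τ y := map_sub (toL2Lin τ) x y

theorem toL2_smul (c : ℂ) (x : M) : toL2 τ (c • x) = c • toL2 τ x := map_smul (toL2Lin τ) c x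

@[simp] theorem toL2_zero : toL2 τ 0 = 0 := map_zero (toL2Lin τ)

theorem ofReal_norm_toL2_sq (x : M) : ((‖toL2 τ x‖ ^ 2 : ℝ) : ℂ) = τ (star x * x) := by
  rw [← inner_toL2, inner_self_eq_norm_sq_to_K]
  simp

theorem norm_toL2_sq (x : M) : ‖toL2 τ x‖ ^ 2 = (τ (star x * x)).re := by
  rw [← ofReal_norm_toL2_sq, Complex.ofReal_re]

theorem toL2_injective : Function.Injective (toL2 τ) := by
  intro x y h
  have h' : toL2 τ (x - y) = 0 := by rw [toL2_sub, h, sub_self]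
  refine sub_eq_zero.1 (τ.faithful _ ?_)
  rw [← ofReal_norm_toL2_sq, h']
  simp

theorem norm_toL2_star (x : M) : ‖toL2 τ (star x)‖ = ‖toL2 τ x‖ := by
  rw [← sq_eq_sq₀ (norm_nonneg _) (norm_nonneg _), norm_toL2_sq, norm_toL2_sq, star_star,
    τ.tracial]

theorem trace_nonneg {x : M} (hx : 0 ≤ x) : 0 ≤ τ x := by
  obtain ⟨s, rfl⟩ := CStarAlgebra.nonneg_iff_eq_star_mul_self.1 hx
  exact τ.nonneg s

theorem trace_mono {x y : M} (h : x ≤ y) : τ x ≤ τ y := by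
  have := trace_nonneg τ (sub_nonneg.2 h)
  rw [map_sub] at this
  exact sub_nonneg.1 this

theorem norm_toL2_mul_le (x y : M) : ‖toL2 τ (x * y)‖ ≤ ‖x‖ * ‖toL2 τ y‖ := by
  refine le_of_sq_le_sq ?_ (by positivity)
  rw [mul_pow, norm_toL2_sq, norm_toL2_sq]
  have h : star (x * y) * (x * y) ≤ (‖x‖ ^ 2 : ℝ) • (star y * y) := by
    rw [star_mul]
    have := star_left_conjugate_le_conjugate
      (CStarAlgebra.star_mul_le_algebraMap_norm_sq (a := x)) y
    calc _ = star y * (star x * x) * y := by noncomm_ring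
      _ ≤ _ := this
      _ = _ := by rw [Algebra.algebraMap_eq_smul_one]; simp
  have := (Complex.le_def.1 (trace_mono τ h)).1
  rwa [← Complex.coe_smul, map_smul, smul_eq_mul, Complex.re_ofReal_mul] at this

theorem norm_toL2_mul_le' (x y : M) : ‖toL2 τ (x * y)‖ ≤ ‖y‖ * ‖toL2 τ x‖ := by
  rw [← norm_toL2_star, star_mul, ← norm_star y, ← norm_toL2_star τ x]
  exact norm_toL2_mul_le τ _ _

theorem norm_toL2_le (x : M) : ‖toL2 τ x‖ ≤ ‖x‖ := by
  have h : ‖toL2 τ 1‖ = 1 := by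
    rw [← sq_eq_sq₀ (norm_nonneg _) zero_le_one, norm_toL2_sq]
    simp [τ.map_one]
  simpa [h] using norm_toL2_mul_le τ x 1

theorem norm_trace_star_mul_le (x y : M) : ‖τ (star x * y)‖ ≤ ‖toL2 τ x‖ * ‖toL2 τ y‖ := by
  rw [← inner_toL2]
  exact norm_inner_le_norm _ _

/-- Write h = s*s and apply Cauchy–Schwarz to s and sz; traciality gives ‖sz‖₂ ≤ ‖z‖‖s‖₂. -/
theorem norm_trace_mul_le {h : M} (hh : 0 ≤ h) (z : M) : ‖τ (h * z)‖ ≤ ‖z‖ * (τ h).re := by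
  obtain ⟨s, rfl⟩ := CStarAlgebra.nonneg_iff_eq_star_mul_self.1 hh
  have h1 : τ (star s * s * z) = τ (star s * (s * z)) := by rw [mul_assoc]
  rw [h1, ← norm_toL2_sq]
  calc _ ≤ ‖toL2 τ s‖ * ‖toL2 τ (s * z)‖ := norm_trace_star_mul_le τ _ _
    _ ≤ ‖toL2 τ s‖ * (‖z‖ * ‖toL2 τ s‖) := by gcongr; exact norm_toL2_mul_le' τ _ _
    _ = _ := by ring

end TraceNorm

/-! ### Limits in ‖·‖₂ and positivity -/

section Limits

variable (τ : FaithfulNormalTracialState M)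

theorem tendsto_toL2_mul_left {ι : Type*} {l : Filter ι} {x : ι → M} {s : M} (y : M)
    (h : Tendsto (fun i => toL2 τ (x i)) l (𝓝 (toL2 τ s))) :
    Tendsto (fun i => toL2 τ (y * x i)) l (𝓝 (toL2 τ (y * s))) := by
  rw [tendsto_iff_norm_sub_tendsto_zero] at h ⊢
  refine squeeze_zero (fun _ => norm_nonneg _) (fun i => ?_) (by simpa using h.const_mul ‖y‖)
  rw [← toL2_sub, ← toL2_sub, ← mul_sub]
  exact norm_toL2_mul_le τ _ _

theorem tendsto_toL2_mul_right {ι : Type*} {l : Filter ι} {x : ι → M} {s : M} (y : M)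
    (h : Tendsto (fun i => toL2 τ (x i)) l (𝓝 (toL2 τ s))) :
    Tendsto (fun i => toL2 τ (x i * y)) l (𝓝 (toL2 τ (s * y))) := by
  rw [tendsto_iff_norm_sub_tendsto_zero] at h ⊢
  refine squeeze_zero (fun _ => norm_nonneg _) (fun i => ?_) (by simpa using h.const_mul ‖y‖)
  rw [← toL2_sub, ← toL2_sub, ← sub_mul]
  exact norm_toL2_mul_le' τ _ _

theorem tendsto_toL2_star {ι : Type*} {l : Filter ι} {x : ι → M} {s : M}
    (h : Tendsto (fun i => toL2 τ (x i)) l (𝓝 (toL2 τ s))) :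
    Tendsto (fun i => toL2 τ (star (x i))) l (𝓝 (toL2 τ (star s))) := by
  rw [tendsto_iff_norm_sub_tendsto_zero] at h ⊢
  simpa only [← toL2_sub, ← star_sub, norm_toL2_star] using h

/-- A self-adjoint element `h` of a norm closed `*`-subalgebra `S` of `M` is positive if
`τ(y* h y) ≥ 0` for all `y ∈ S`. -/
theorem nonneg_of_trace_conj_nonneg (S : StarSubalgebra ℂ M) (hS : IsClosed (S : Set M)) {h : M}
    (hsa : IsSelfAdjoint h) (hmem : h ∈ S) (hp : ∀ y ∈ S, 0 ≤ τ (star y * h * y)) : 0 ≤ h := by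
  have hm : h⁻ ∈ S := by
    rw [CFC.negPart_def, cfcₙ_eq_cfc]
    exact cfc_mem (𝕜' := ℂ) _ hmem
  have hm0 : 0 ≤ h⁻ := CFC.negPart_nonneg h
  -- Testing the hypothesis on y = h⁻ gives τ((h⁻)³) ≤ 0, and faithfulness then kills h⁻.
  have h1 : star (h⁻) * h * h⁻ = -(star (h⁻) * h⁻ * h⁻) := by
    nth_rw 2 [← CFC.posPart_sub_negPart h]
    rw [mul_sub, sub_mul, hm0.isSelfAdjoint.star_eq, CFC.negPart_mul_posPart]
    simp
  have h2 := hp _ hm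
  have h3 : 0 ≤ star (h⁻) * h⁻ * h⁻ := by
    rw [mul_assoc, ← mul_assoc, hm0.isSelfAdjoint.star_eq]
    nth_rw 1 [← hm0.isSelfAdjoint.star_eq]
    exact star_left_conjugate_nonneg hm0 _
  obtain ⟨s, hs⟩ := CStarAlgebra.nonneg_iff_eq_star_mul_self.1 h3
  have h4 : τ (star s * s) = 0 := by
    refine le_antisymm ?_ (τ.nonneg s)
    rw [h1, map_neg, hs] at h2
    exact neg_nonneg.1 h2
  have h5 : h⁻ ^ 3 = 0 := by
    rw [τ.faithful s h4, mul_zero, hm0.isSelfAdjoint.star_eq] at hs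
    rw [pow_succ, pow_two, hs]
  have h6 : h⁻ = 0 := by
    have h7 : star (h⁻ * h⁻) * (h⁻ * h⁻) = 0 := by
      rw [star_mul, hm0.isSelfAdjoint.star_eq]
      calc _ = h⁻ ^ 3 * h⁻ := by noncomm_ring
        _ = 0 := by rw [h5, zero_mul]
    have h8 : star (h⁻) * h⁻ = 0 := by
      rw [hm0.isSelfAdjoint.star_eq]
      exact (CStarRing.star_mul_self_eq_zero_iff _).1 h7
    exact (CStarRing.star_mul_self_eq_zero_iff _).1 h8
  rw [← CFC.posPart_sub_negPart h, h6, sub_zero]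
  exact CFC.posPart_nonneg h

theorem nonneg_of_tendsto_toL2 {ι : Type*} {l : Filter ι} [l.NeBot] {x : ι → M} {s : M}
    (h : Tendsto (fun i => toL2 τ (x i)) l (𝓝 (toL2 τ s))) (hx : ∀ᶠ i in l, 0 ≤ x i) : 0 ≤ s := by
  refine nonneg_of_trace_conj_nonneg τ ⊤ (by simp) ?_ (by simp) fun y _ => ?_
  · refine toL2_injective τ (tendsto_nhds_unique (tendsto_toL2_star τ h) ?_)
    refine h.congr' (hx.mono fun i hi => ?_)
    simp only [hi.isSelfAdjoint.star_eq]
  · have h1 := (tendsto_const_nhds (x := toL2 τ y)).inner (𝕜 := ℂ) (tendsto_toL2_mul_right τ y h)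
    simp only [inner_toL2, ← mul_assoc] at h1
    exact ge_of_tendsto h1 (hx.mono fun i hi => trace_nonneg τ (star_left_conjugate_nonneg hi y))

theorem le_of_tendsto_toL2 {ι : Type*} {l : Filter ι} [l.NeBot] {x y : ι → M} {s t : M}
    (hx : Tendsto (fun i => toL2 τ (x i)) l (𝓝 (toL2 τ s)))
    (hy : Tendsto (fun i => toL2 τ (y i)) l (𝓝 (toL2 τ t))) (h : ∀ᶠ i in l, x i ≤ y i) : s ≤ t := by
  refine sub_nonneg.1 (nonneg_of_tendsto_toL2 τ (l := l) (x := fun i => y i - x i) ?_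
    (h.mono fun i hi => sub_nonneg.2 hi))
  simpa only [toL2_sub] using hy.sub hx

end Limits

/-! ### Orbits in ℓ²(ℕ, H) and their maps to L²(M) -/

section Orbits

/-- The subspace `N y` of `ℓ²(ℕ, H)`. -/
noncomputable def orbit (N : Submodule ℂ M) (y : Ampl H) : Submodule ℂ (Ampl H) :=
  N.map (((ContinuousLinearMap.apply ℂ (Ampl H) y).toLinearMap).comp (rep M).toLinearMap)

theorem mem_orbit {N : Submodule ℂ M} {y z : Ampl H} :
    z ∈ orbit N y ↔ ∃ x ∈ N, rep M x y = z := by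
  simp [orbit]

theorem rep_mem_orbit {N : Submodule ℂ M} {x : M} (hx : x ∈ N) (y : Ampl H) :
    rep M x y ∈ orbit N y := mem_orbit.2 ⟨x, hx, rfl⟩

/-- A contraction `x y ↦ x` from the closure of `N y` to `L²(M, τ)`, extended by zero to the
orthogonal complement. -/
theorem exists_extension (τ : FaithfulNormalTracialState M) (N : Submodule ℂ M) (y : Ampl H)
    (hy : ∀ x ∈ N, ‖toL2 τ x‖ ≤ ‖rep M x y‖) :
    ∃ V : Ampl H →L[ℂ] L2 τ, (∀ x ∈ N, V (rep M x y) = toL2 τ x) ∧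
      ∀ z, (∀ x ∈ N, inner ℂ (rep M x y) z = 0) → V z = 0 := by
  let Y := (orbit N y).topologicalClosure
  have hYc : IsClosed (Y : Set (Ampl H)) := (orbit N y).isClosed_topologicalClosure
  have : CompleteSpace Y := hYc.completeSpace_coe
  let e0 : N →ₗ[ℂ] Ampl H :=
    (((ContinuousLinearMap.apply ℂ (Ampl H) y).toLinearMap).comp (rep M).toLinearMap).comp N.subtype
  have he0 : ∀ x : N, e0 x ∈ Y := fun x =>
    (orbit N y).le_topologicalClosure (rep_mem_orbit x.2 y)
  let e : N →ₗ[ℂ] Y := e0.codRestrict Y he0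
  let f : N →ₗ[ℂ] L2 τ := (toL2Lin τ).comp N.subtype
  have hd : DenseRange e := by
    intro z
    have hz : (z : Ampl H) ∈ closure (orbit N y : Set (Ampl H)) := z.2
    rw [mem_closure_iff_seq_limit] at hz ⊢
    obtain ⟨s, hs, hlim⟩ := hz
    choose t ht hts using fun n => mem_orbit.1 (hs n)
    refine ⟨fun n => e ⟨t n, ht n⟩, fun n => ⟨_, rfl⟩, ?_⟩
    rw [tendsto_subtype_rng]
    convert hlim using 1
    ext1 n
    exact hts n
  have hn : ∃ C, ∀ x, ‖f x‖ ≤ C * ‖e x‖ := ⟨1, fun x => by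
    rw [one_mul]; exact hy x x.2⟩
  refine ⟨(f.extendOfNorm e).comp Y.orthogonalProjectionOnto, fun x hx => ?_, fun z hz => ?_⟩
  · have h1 : Y.orthogonalProjectionOnto (rep M x y) = e ⟨x, hx⟩ :=
      Y.orthogonalProjectionOnto_mem_subspace_eq_self (e ⟨x, hx⟩)
    rw [ContinuousLinearMap.comp_apply, h1, LinearMap.extendOfNorm_eq hd hn]
    rfl
  · have h1 : z ∈ Yᗮ := by
      rw [Submodule.orthogonal_closure]
      rw [Submodule.mem_orthogonal]
      rintro _ hu
      obtain ⟨x, hx, rfl⟩ := mem_orbit.1 hu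
      exact hz x hx
    rw [ContinuousLinearMap.comp_apply,
      Submodule.orthogonalProjectionOnto_eq_zero_iff.2 h1, map_zero]

/-- By normality τ(x*x) = ⟨xξ, xη⟩ for some ξ, η, and Re⟨u, v⟩ ≤ ‖(u + v)/2‖². -/
theorem exists_dominating_vector (τ : FaithfulNormalTracialState M) :
    ∃ ζ : Ampl H, ∀ x : M, ‖toL2 τ x‖ ≤ ‖rep M x ζ‖ := by
  obtain ⟨ξ, η, h⟩ := exists_vecFun_eq (φ := τ.toLinearMap) τ.normal
  refine ⟨(2⁻¹ : ℂ) • (ξ + η), fun x => le_of_sq_le_sq ?_ (norm_nonneg _)⟩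
  have h1 : τ (star x * x) = inner ℂ (rep M x ξ) (rep M x η) := by
    rw [h, vecFun_apply, map_mul, inner_rep_left]; rfl
  have h2 := @norm_add_sq ℂ _ _ _ _ (rep M x ξ) (rep M x η)
  have h3 := @norm_sub_sq ℂ _ _ _ _ (rep M x ξ) (rep M x η)
  rw [norm_toL2_sq, h1, map_smul, map_add, norm_smul, mul_pow, h2]
  have h4 := sq_nonneg ‖rep M x ξ - rep M x η‖
  have h5 : ‖(2⁻¹ : ℂ)‖ = 2⁻¹ := by simp
  rw [h5]
  simp only [RCLike.re_eq_complex_re] at *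
  nlinarith

/-- Here `s` is any vector of L²(M), not only an element of M: as x = V(xζ) for a bounded V, this is
the vector functional of V*s and ζ. -/
theorem weakStarContinuous_inner_toL2 (τ : FaithfulNormalTracialState M) (s : L2 τ) :
    WeakStarContinuous fun x : M => inner ℂ s (toL2 τ x) := by
  obtain ⟨ζ, hζ⟩ := exists_dominating_vector τ
  obtain ⟨V, hV, -⟩ := exists_extension τ ⊤ ζ fun x _ => hζ x
  convert weakStarContinuous_vecFun (M := M) (ContinuousLinearMap.adjoint V s) ζ using 2 with x
  rw [vecFun_apply, ContinuousLinearMap.adjoint_inner_left, hV x trivial]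

end Orbits

/-! ### Weak* compactness of balls -/

section Compactness

/-- The limit of the forms ⟨xᵢ v, w⟩ is a bounded sesquilinear form, hence an operator. It commutes
with the commutant of M because each xᵢ does, so it lies in the bicommutant M. -/
theorem exists_weak_ultralimit {ι : Type*} (𝒰 : Ultrafilter ι) (x : ι → M) (R : ℝ)
    (hx : ∀ i, ‖x i‖ ≤ R) : ∃ a : M, ‖a‖ ≤ R ∧ ∀ v w : H,
      Tendsto (fun i => inner ℂ ((x i : H →L[ℂ] H) v) w) 𝒰 (𝓝 (inner ℂ ((a : H →L[ℂ] H) v) w)) := by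
  have hbd : ∀ v w i, ‖inner ℂ ((x i : H →L[ℂ] H) v) w‖ ≤ R * ‖v‖ * ‖w‖ := fun v w i =>
    (norm_inner_le_norm _ _).trans (mul_le_mul_of_nonneg_right
      ((ContinuousLinearMap.le_opNorm _ _).trans
        (mul_le_mul_of_nonneg_right (hx i) (norm_nonneg _))) (norm_nonneg _))
  have hlim : ∀ v w, ∃ c : ℂ, ‖c‖ ≤ R * ‖v‖ * ‖w‖ ∧
      Tendsto (fun i => inner ℂ ((x i : H →L[ℂ] H) v) w) 𝒰 (𝓝 c) := fun v w => by
    obtain ⟨c, hc, hle⟩ := (isCompact_closedBall (0 : ℂ) (R * ‖v‖ * ‖w‖)).ultrafilter_le_nhds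
      (𝒰.map fun i => inner ℂ ((x i : H →L[ℂ] H) v) w) (by
        rw [le_principal_iff]
        exact Filter.mem_map.2 (Eventually.of_forall fun i => by simpa using hbd v w i))
    exact ⟨c, by simpa using hc, hle⟩
  choose B hB hBt using hlim
  let Bl : H →ₗ⋆[ℂ] H →ₗ[ℂ] ℂ := LinearMap.mk₂'ₛₗ (starRingEnd ℂ) (RingHom.id ℂ) B
    (fun v v' w => tendsto_nhds_unique (hBt _ _)
      (by simpa [inner_add_left] using (hBt v w).add (hBt v' w)))
    (fun c v w => tendsto_nhds_unique (hBt _ _)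
      (by simpa [inner_smul_left, mul_comm] using (hBt v w).const_mul (starRingEnd ℂ c)))
    (fun v w w' => tendsto_nhds_unique (hBt _ _)
      (by simpa [inner_add_right] using (hBt v w).add (hBt v w')))
    (fun c v w => tendsto_nhds_unique (hBt _ _)
      (by simpa [inner_smul_right] using (hBt v w).const_mul c))
  let Bc : H →L⋆[ℂ] H →L[ℂ] ℂ := Bl.mkContinuous₂ R hB
  let T := InnerProductSpace.continuousLinearMapOfBilin Bc
  have hT : ∀ v w, inner ℂ (T v) w = B v w := fun v w =>
    InnerProductSpace.continuousLinearMapOfBilin_apply Bc v w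
  have hR : 0 ≤ R := by
    obtain ⟨i⟩ := 𝒰.neBot.nonempty
    exact (norm_nonneg _).trans (hx i)
  have hmem : T ∈ M := by
    have : T ∈ Set.centralizer (Set.centralizer (M : Set (H →L[ℂ] H))) := by
      rw [Set.mem_centralizer_iff]
      intro c hc
      ext1 v
      refine ext_inner_right ℂ fun w => ?_
      rw [mul_apply_eq_comp, mul_apply_eq_comp, hT,
        ← ContinuousLinearMap.adjoint_inner_right, hT]
      refine tendsto_nhds_unique (hBt _ _) ((hBt (c v) w).congr fun i => ?_)
      rw [ContinuousLinearMap.adjoint_inner_right, ← mul_apply_eq_comp,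
        ← mul_apply_eq_comp, Set.mem_centralizer_iff.1 hc _ (x i).2]
    rwa [M.centralizer_centralizer] at this
  refine ⟨⟨T, hmem⟩, ?_, fun v w => by rw [hT]; exact hBt v w⟩
  refine ContinuousLinearMap.opNorm_le_bound _ hR fun v => ?_
  change ‖T v‖ ≤ R * ‖v‖
  rcases eq_or_ne (T v) 0 with h0 | h0
  · rw [h0, norm_zero]; positivity
  · have h1 : ‖T v‖ * ‖T v‖ ≤ R * ‖v‖ * ‖T v‖ := by
      have := hB v (T v)
      rw [← hT, inner_self_eq_norm_sq_to_K] at this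
      simpa [pow_two] using this
    exact le_of_mul_le_mul_right h1 (norm_pos_iff.2 h0)

/-- Bounded sets in `M` are relatively weak* compact. -/
theorem exists_weakStar_ultralimit {ι : Type*} (𝒰 : Ultrafilter ι) (x : ι → M) (R : ℝ)
    (hx : ∀ i, ‖x i‖ ≤ R) :
    ∃ a : M, ‖a‖ ≤ R ∧ Tendsto x 𝒰 (@nhds M (weakStarTopology M) a) := by
  obtain ⟨a, ha, hlim⟩ := exists_weak_ultralimit 𝒰 x R hx
  refine ⟨a, ha, ?_⟩
  rw [weakStarTopology_eq, nhds_iInf, tendsto_iInf]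
  intro p
  rw [nhds_induced, tendsto_comap_iff]
  have key : Tendsto (fun i => ∑' n, inner ℂ (p.1 n) ((x i : H →L[ℂ] H) (p.2 n))) 𝒰
      (𝓝 (∑' n, inner ℂ (p.1 n) ((a : H →L[ℂ] H) (p.2 n)))) := by
    refine tendsto_tsum_of_dominated_convergence
      (bound := fun n => R * (‖p.1 n‖ ^ 2 + ‖p.2 n‖ ^ 2))
      (((Ampl.summable p.1).add (Ampl.summable p.2)).mul_left R) (fun n => ?_)
      (Eventually.of_forall fun i n => ?_)
    · have := (Complex.continuous_conj.tendsto _).comp (hlim (p.2 n) (p.1 n))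
      simpa [Function.comp_def] using this
    · have h1 : ‖(x i : H →L[ℂ] H) (p.2 n)‖ ≤ R * ‖p.2 n‖ :=
        (ContinuousLinearMap.le_opNorm _ _).trans
          (mul_le_mul_of_nonneg_right (hx i) (norm_nonneg _))
      have hR : 0 ≤ R := (norm_nonneg _).trans (hx i)
      calc _ ≤ ‖p.1 n‖ * ‖(x i : H →L[ℂ] H) (p.2 n)‖ := norm_inner_le_norm _ _
        _ ≤ ‖p.1 n‖ * (R * ‖p.2 n‖) := by gcongr
        _ ≤ _ := by nlinarith [sq_nonneg (‖p.1 n‖ - ‖p.2 n‖),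
            mul_nonneg hR (sq_nonneg (‖p.1 n‖ - ‖p.2 n‖)),
            mul_nonneg hR (add_nonneg (sq_nonneg ‖p.1 n‖) (sq_nonneg ‖p.2 n‖))]
  have e : ∀ b : M, vecFun M p.1 p.2 b = ∑' n, inner ℂ (p.1 n) ((b : H →L[ℂ] H) (p.2 n)) :=
    fun b => by rw [vecFun_apply, lp.inner_eq_tsum]; rfl
  rw [e]
  exact key.congr fun i => (e _).symm

variable (τ : FaithfulNormalTracialState M)

/-- Balls of weak* closed sets are complete in `‖·‖₂`. -/
theorem exists_of_tendsto_toL2 {S : Set M} (hS : @IsClosed M (weakStarTopology M) S)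
    {ι : Type*} {l : Filter ι} [l.NeBot] {x : ι → M}
    {R : ℝ} (hx : ∀ n, ‖x n‖ ≤ R) (hxS : ∀ n, x n ∈ S) {s : L2 τ}
    (h : Tendsto (fun n => toL2 τ (x n)) l (𝓝 s)) : ∃ a ∈ S, ‖a‖ ≤ R ∧ toL2 τ a = s := by
  let 𝒰 : Ultrafilter ι := Ultrafilter.of l
  have hle : (𝒰 : Filter ι) ≤ l := Ultrafilter.of_le l
  obtain ⟨a, ha, hlim⟩ := exists_weakStar_ultralimit 𝒰 x R hx
  refine ⟨a, ?_, ha, ?_⟩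
  · exact let _ := weakStarTopology M
      IsClosed.mem_of_tendsto hS hlim
      (Eventually.of_forall hxS)
  · refine ext_inner_left ℂ fun v => ?_
    refine tendsto_nhds_unique (f := fun n => inner ℂ v (toL2 τ (x n))) (l := (𝒰 : Filter ι)) ?_
      ((tendsto_const_nhds (x := v)).inner (h.mono_left hle))
    exact (@Continuous.tendsto _ _ (weakStarTopology M) _ _
      (weakStarContinuous_inner_toL2 τ v) a).comp hlim

/-- On bounded sets, convergence in `‖·‖₂` implies weak* convergence. -/
theorem tendsto_vecFun_of_tendsto_toL2_zero {x : ℕ → M} {R : ℝ} (hx : ∀ n, ‖x n‖ ≤ R)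
    (h : Tendsto (fun n => ‖toL2 τ (x n)‖) atTop (𝓝 0)) (ξ η : Ampl H) :
    Tendsto (fun n => inner ℂ ξ (rep M (x n) η)) atTop (𝓝 0) := by
  rw [tendsto_iff_ultrafilter]
  intro 𝒰 hle
  obtain ⟨a, -, hlim⟩ := exists_weakStar_ultralimit 𝒰 x R hx
  have ha : a = 0 := by
    refine toL2_injective τ (ext_inner_left ℂ fun v => ?_)
    refine tendsto_nhds_unique (f := fun n => inner ℂ v (toL2 τ (x n))) (l := (𝒰 : Filter ℕ))
      ((@Continuous.tendsto _ _ (weakStarTopology M) _ _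
        (weakStarContinuous_inner_toL2 τ v) a).comp hlim) ?_
    rw [toL2_zero]
    exact (tendsto_const_nhds (x := v)).inner
      ((tendsto_zero_iff_norm_tendsto_zero.2 h).mono_left hle)
  have := (@Continuous.tendsto _ _ (weakStarTopology M) _ _
    (weakStarContinuous_vecFun ξ η) a).comp hlim
  simpa [ha, Function.comp_def, vecFun_apply] using this

end Compactness

/-! ### Approximate polar decomposition -/

section Polar

variable (τ : FaithfulNormalTracialState M)

theorem isClosed_of_weakStar_isClosed (τ : FaithfulNormalTracialState M) {S : Set M}
    (hS : @IsClosed M (weakStarTopology M) S) : IsClosed S := by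
  refine IsSeqClosed.isClosed fun x s hx hs => ?_
  have hb : ∃ R, ∀ n, ‖x n‖ ≤ R := by
    obtain ⟨R, hR⟩ := (Metric.isBounded_range_of_tendsto x hs).exists_norm_le
    exact ⟨R, fun n => hR _ ⟨n, rfl⟩⟩
  obtain ⟨R, hR⟩ := hb
  have h2 : Tendsto (fun n => toL2 τ (x n)) atTop (𝓝 (toL2 τ s)) := by
    rw [tendsto_iff_norm_sub_tendsto_zero] at hs ⊢
    refine squeeze_zero (fun _ => norm_nonneg _) (fun n => ?_) hs
    rw [← toL2_sub]
    exact norm_toL2_le τ _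
  obtain ⟨a, ha, -, has⟩ := exists_of_tendsto_toL2 τ hS hR hx h2
  rwa [← toL2_injective τ has]

/-- An approximate polar decomposition, showing that `‖τ(y* ·)‖` is almost attained on the unit ball
of any norm closed `*`-subalgebra that contains `y`. -/
theorem exists_approx_polar (D : StarSubalgebra ℂ M) (hD : IsClosed (D : Set M)) {y : M}
    (hy : y ∈ D) {ε : ℝ} (hε : 0 < ε) : ∃ k ∈ D, ‖k‖ ≤ 1 ∧
      ∀ x : M, ‖τ (star y * x)‖ ≤ ‖x‖ * ((τ (star y * k)).re + ε) := by
  set a : M := star y * y with ha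
  have ha0 : 0 ≤ a := star_mul_self_nonneg y
  have hsp : ∀ t ∈ spectrum ℝ a, 0 ≤ t := fun t ht => spectrum_nonneg_of_nonneg ha0 ht
  -- `p a` is an invertible substitute for |y|, and y · (p a)⁻¹ for the polar part. The absolute
  -- value only makes `p` positive on all of ℝ; the spectrum of `a` is nonnegative.
  let p : ℝ → ℝ := fun t => √(|t| + ε ^ 2)
  have hp : ∀ t, 0 < p t := fun t => Real.sqrt_pos.2 (by positivity)
  have hpsq : ∀ t, p t ^ 2 = |t| + ε ^ 2 := fun t => Real.sq_sqrt (by positivity)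
  have hpc : Continuous p := by fun_prop
  have hqc : Continuous fun t => (p t)⁻¹ := hpc.inv₀ fun t => (hp t).ne'
  have hqc' : Continuous fun t => t * (p t)⁻¹ := continuous_id.mul hqc
  set h : M := cfc p a with hh
  set r : M := cfc (fun t => (p t)⁻¹) a with hr
  have hrD : r ∈ D := cfc_mem (𝕜' := ℂ) _ (D.mul_mem (D.star_mem' hy) hy)
  have hrs : star r = r := IsSelfAdjoint.star_eq (cfc_predicate _ _)
  have h0 : 0 ≤ h := cfc_nonneg fun t _ => (hp t).le
  have hrh : r * h = 1 := by
    rw [hr, hh, ← cfc_mul _ _ a hqc.continuousOn hpc.continuousOn, ← cfc_one ℝ a]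
    exact cfc_congr fun t _ => inv_mul_cancel₀ (hp t).ne'
  have har : a * r = cfc (fun t => t * (p t)⁻¹) a := by
    rw [cfc_mul (fun t => t) _ a continuousOn_id hqc.continuousOn, cfc_id' ℝ a]
  have hrar : r * a * r = cfc (fun t => (p t)⁻¹ * (t * (p t)⁻¹)) a := by
    rw [mul_assoc, har, ← cfc_mul _ _ a hqc.continuousOn hqc'.continuousOn]
  have hk : ‖y * r‖ ≤ 1 := by
    have h1 : ‖y * r‖ * ‖y * r‖ = ‖r * a * r‖ := by
      rw [← CStarRing.norm_star_mul_self, star_mul, hrs, ha]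
      noncomm_ring
    have h2 : ‖r * a * r‖ ≤ 1 := by
      rw [hrar]
      refine norm_cfc_le zero_le_one fun t ht => ?_
      have ht0 := hsp t ht
      have e : (p t)⁻¹ * (t * (p t)⁻¹) = t / p t ^ 2 := by field_simp
      rw [e, hpsq, abs_of_nonneg ht0, Real.norm_of_nonneg (by positivity)]
      exact (div_le_one (by positivity)).2 (by nlinarith [sq_nonneg ε])
    nlinarith [norm_nonneg (y * r)]
  refine ⟨y * r, D.mul_mem hy hrD, hk, fun x => ?_⟩
  · have h1 : star y * x = h * (star (y * r) * x) := by
      have : star y = h * star (y * r) := by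
        conv_lhs => rw [← mul_one y, ← hrh, ← mul_assoc, star_mul, h0.isSelfAdjoint.star_eq]
      rw [← mul_assoc, ← this]
    have h2 : (τ h).re ≤ (τ (star y * (y * r))).re + ε := by
      -- Pointwise p ≤ t/p + ε, because p² = t + ε² and ε ≤ p.
      have h3 : h ≤ a * r + algebraMap ℝ M ε := by
        rw [har, hh, ← cfc_add_const ε _ a hqc'.continuousOn]
        refine cfc_mono (fun t ht => ?_) hpc.continuousOn
          (hqc'.add continuous_const).continuousOn
        have ht0 := hsp t ht
        have h4 : ε ≤ p t := Real.le_sqrt_of_sq_le (by simp)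
        have h5 := hpsq t
        rw [abs_of_nonneg ht0] at h5
        have h6 : t * (p t)⁻¹ + ε = (t + ε * p t) / p t := by field_simp [(hp t).ne']
        rw [h6, le_div_iff₀ (hp t)]
        nlinarith
      have h4 := (Complex.le_def.1 (trace_mono τ h3)).1
      have h5 : algebraMap ℝ M ε = (ε : ℂ) • (1 : M) := by
        rw [Algebra.algebraMap_eq_smul_one, Complex.coe_smul]
      rw [h5, map_add, map_smul, τ.map_one] at h4
      rw [← mul_assoc]
      simpa using h4
    rw [h1]
    refine (norm_trace_mul_le τ h0 _).trans ?_
    have h4 : 0 ≤ (τ h).re := (Complex.le_def.1 (trace_nonneg τ h0)).1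
    refine mul_le_mul ((norm_mul_le _ _).trans ?_) h2 h4 (norm_nonneg _)
    rw [norm_star]
    exact mul_le_of_le_one_left (norm_nonneg _) hk

end Polar


/-! ### The trace-preserving conditional expectation -/

section Expectation

variable (τ : FaithfulNormalTracialState M)

/-- The projection s of x onto the closure of D in L²(M) has the right pairings; the point is that s
comes from D. If not, Hahn–Banach separates it from the convex, ‖·‖₂-closed ball K of radius ‖x‖ in
D. Approximating the separating vector by y ∈ D, the approximate polar decomposition of y yields an
element of K where the functional is almost as large as at s. -/
theorem exists_trace_eq (D : StarSubalgebra ℂ M)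
    (hD : @IsClosed M (weakStarTopology M) (D : Set M)) (x : M) :
    ∃ d ∈ D, ∀ e ∈ D, τ (star e * d) = τ (star e * x) := by
  have hDn : IsClosed (D : Set M) := isClosed_of_weakStar_isClosed τ hD
  let Y : Submodule ℂ (L2 τ) := (D.toSubalgebra.toSubmodule.map (toL2Lin τ)).topologicalClosure
  have hYc : IsClosed (Y : Set (L2 τ)) := Submodule.isClosed_topologicalClosure _
  have : CompleteSpace Y := hYc.completeSpace_coe
  have hDY : ∀ d ∈ D, toL2 τ d ∈ Y := fun d hd =>
    Submodule.le_topologicalClosure _ (Submodule.mem_map.2 ⟨d, hd, rfl⟩)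
  let s : L2 τ := Y.starProjection (toL2 τ x)
  have hs : ∀ v ∈ Y, inner ℂ v s = inner ℂ v (toL2 τ x) := fun v hv => by
    rw [← Submodule.inner_starProjection_left_eq_right, Submodule.starProjection_eq_self_iff.2 hv]
  have hsn : ‖s‖ ≤ ‖x‖ := (Y.norm_starProjection_apply_le _).trans (norm_toL2_le τ x)
  let K : Set (L2 τ) := toL2 τ '' {d | d ∈ D ∧ ‖d‖ ≤ ‖x‖}
  have hKconv : Convex ℝ K := by
    have h1 : Convex ℝ ((D : Set M) ∩ Metric.closedBall 0 ‖x‖) :=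
      (D.toSubalgebra.toSubmodule.restrictScalars ℝ).convex.inter (convex_closedBall 0 ‖x‖)
    have h2 := h1.linear_image ((toL2Lin τ).restrictScalars ℝ)
    have h3 : {d | d ∈ D ∧ ‖d‖ ≤ ‖x‖} = (D : Set M) ∩ Metric.closedBall 0 ‖x‖ := by
      ext d; simp
    change Convex ℝ (toL2 τ '' _)
    rw [h3]
    exact h2
  have hKcl : IsClosed K := by
    refine IsSeqClosed.isClosed fun z t hz ht => ?_
    choose d hd hdz using hz
    obtain ⟨a, ha, han, hat⟩ := exists_of_tendsto_toL2 τ hD (x := d) (fun n => (hd n).2)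
      (fun n => (hd n).1) (ht.congr fun n => (hdz n).symm)
    exact ⟨a, ⟨ha, han⟩, hat⟩
  have hsK : s ∈ K := by
    by_contra hsK
    obtain ⟨f, u, hfu, hus⟩ := RCLike.geometric_hahn_banach_closed_point (𝕜 := ℂ) hKconv hKcl hsK
    let v : L2 τ := Y.starProjection ((InnerProductSpace.toDual ℂ (L2 τ)).symm f)
    have hv : ∀ z ∈ Y, f z = inner ℂ v z := fun z hz => by
      rw [Submodule.inner_starProjection_left_eq_right, Submodule.starProjection_eq_self_iff.2 hz,
        InnerProductSpace.toDual_symm_apply]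
    have hvY : v ∈ Y := Submodule.starProjection_apply_mem _ _
    have hsY : s ∈ Y := Submodule.starProjection_apply_mem _ _
    set γ := RCLike.re (f s) - u with hγ
    have hγ0 : 0 < γ := sub_pos.2 hus
    -- Three errors of size ε‖x‖ arise: one from the polar decomposition and two from replacing `v`
    -- by `y`. Their sum stays below γ, and the +1 covers x = 0.
    set ε := γ / (4 * (‖x‖ + 1)) with hε
    have hε0 : 0 < ε := by positivity
    obtain ⟨_, ⟨y, hy, rfl⟩, hyv⟩ := Metric.mem_closure_iff.1 (show v ∈ closure _ from hvY) ε hε0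
    replace hyv : ‖v - toL2 τ y‖ < ε := by rwa [dist_eq_norm] at hyv
    obtain ⟨k, hk, hk1, hkx⟩ := exists_approx_polar τ D hDn hy hε0
    have h1 := hkx x
    have hkD : (‖x‖ : ℂ) • k ∈ D := D.toSubalgebra.smul_mem hk _
    have hkn : ‖(‖x‖ : ℂ) • k‖ ≤ ‖x‖ := by
      rw [norm_smul]
      simpa using mul_le_of_le_one_right (norm_nonneg x) hk1
    have h2 := hfu (toL2 τ ((‖x‖ : ℂ) • k)) ⟨_, ⟨hkD, hkn⟩, rfl⟩
    rw [hv _ (hDY _ hkD)] at h2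
    have h3 : f s = inner ℂ v s := hv s hsY
    have h4 : inner ℂ v s = τ (star y * x) + inner ℂ (v - toL2 τ y) s := by
      rw [← inner_toL2, ← hs _ (hDY y hy), ← inner_add_left]
      simp
    have h5 : inner ℂ v (toL2 τ ((‖x‖ : ℂ) • k)) =
        ‖x‖ * τ (star y * k) + inner ℂ (v - toL2 τ y) (toL2 τ ((‖x‖ : ℂ) • k)) := by
      have : (‖x‖ : ℂ) * τ (star y * k) = inner ℂ (toL2 τ y) (toL2 τ ((‖x‖ : ℂ) • k)) := by
        rw [toL2_smul, inner_smul_right, inner_toL2]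
      rw [this, ← inner_add_left]
      simp
    have h6 : ‖inner ℂ (v - toL2 τ y) s‖ ≤ ε * ‖x‖ :=
      (norm_inner_le_norm _ _).trans (mul_le_mul hyv.le hsn (norm_nonneg _) hε0.le)
    have h7 : ‖inner ℂ (v - toL2 τ y) (toL2 τ ((‖x‖ : ℂ) • k))‖ ≤ ε * ‖x‖ :=
      (norm_inner_le_norm _ _).trans (mul_le_mul hyv.le ((norm_toL2_le τ _).trans hkn)
        (norm_nonneg _) hε0.le)
    have h8 := (Complex.re_le_norm _).trans h6
    have h9 := (abs_le.1 ((Complex.abs_re_le_norm _).trans h7)).1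
    have h10 := (Complex.re_le_norm _).trans h1
    rw [h5] at h2
    rw [h3, h4] at hγ
    simp only [RCLike.re_eq_complex_re, Complex.add_re, Complex.re_ofReal_mul] at h2 hγ
    have h11 : γ = 4 * ε * (‖x‖ + 1) := by rw [hε]; field_simp
    nlinarith [norm_nonneg x]
  obtain ⟨d, ⟨hd, -⟩, hds⟩ := hsK
  refine ⟨d, hd, fun e he => ?_⟩
  rw [← inner_toL2, ← inner_toL2, hds, hs _ (hDY e he)]

/-- `Ψ` is the `τ`-preserving conditional expectation onto the `*`-subalgebra `D`, described by its
values in `D` and by duality. -/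
structure IsTraceExpectation (D : StarSubalgebra ℂ M) (Ψ : M →ₗ[ℂ] M) : Prop where
  map_mem : ∀ x, Ψ x ∈ D
  trace_mul : ∀ x, ∀ e ∈ D, τ (e * Ψ x) = τ (e * x)

variable {τ}

theorem eq_of_trace_mul_eq {D : StarSubalgebra ℂ M} {x y : M} (hx : x ∈ D) (hy : y ∈ D)
    (h : ∀ e ∈ D, τ (e * x) = τ (e * y)) : x = y := by
  have h1 := h _ (D.star_mem' (D.sub_mem hx hy))
  refine sub_eq_zero.1 (τ.faithful _ ?_)
  rw [mul_sub, map_sub, h1, sub_self]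

variable (τ)

theorem exists_isTraceExpectation (D : StarSubalgebra ℂ M)
    (hD : @IsClosed M (weakStarTopology M) (D : Set M)) :
    ∃ Ψ : M →ₗ[ℂ] M, IsTraceExpectation τ D Ψ := by
  choose E hE hEτ using exists_trace_eq τ D hD
  have hEτ' : ∀ x, ∀ e ∈ D, τ (e * E x) = τ (e * x) := fun x e he => by
    simpa using hEτ x (star e) (D.star_mem' he)
  refine ⟨{ toFun := E, map_add' := fun x y => ?_, map_smul' := fun c x => ?_ }, hE, hEτ'⟩
  · refine eq_of_trace_mul_eq (τ := τ) (hE _) (D.add_mem (hE _) (hE _)) fun e he => ?_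
    rw [hEτ' _ _ he, mul_add, mul_add, map_add, map_add, hEτ' _ _ he, hEτ' _ _ he]
  · refine eq_of_trace_mul_eq (τ := τ) (hE _) (D.toSubalgebra.smul_mem (hE _) _) fun e he => ?_
    rw [hEτ' _ _ he, RingHom.id_apply, mul_smul_comm, mul_smul_comm, map_smul, map_smul,
      hEτ' _ _ he]

namespace IsTraceExpectation

variable {τ} {D : StarSubalgebra ℂ M} {Ψ : M →ₗ[ℂ] M}

theorem eq_of_trace_mul (h : IsTraceExpectation τ D Ψ) {x d : M} (hd : d ∈ D)
    (hx : ∀ e ∈ D, τ (e * d) = τ (e * x)) : Ψ x = d :=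
  eq_of_trace_mul_eq (τ := τ) (h.map_mem x) hd fun e he => by rw [h.trace_mul x e he, hx e he]

theorem map_eq_self (h : IsTraceExpectation τ D Ψ) {d : M} (hd : d ∈ D) : Ψ d = d :=
  h.eq_of_trace_mul hd fun _ _ => rfl

theorem map_mul_mul (h : IsTraceExpectation τ D Ψ) {d e : M} (hd : d ∈ D) (he : e ∈ D) (x : M) :
    Ψ (d * x * e) = d * Ψ x * e := by
  refine h.eq_of_trace_mul (D.mul_mem (D.mul_mem hd (h.map_mem x)) he) fun f hf => ?_
  rw [← mul_assoc, τ.tracial, ← mul_assoc, ← mul_assoc, h.trace_mul x _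
    (D.mul_mem (D.mul_mem he hf) hd), mul_assoc, mul_assoc, τ.tracial, mul_assoc, mul_assoc]

theorem trace_eq (h : IsTraceExpectation τ D Ψ) (x : M) : τ (Ψ x) = τ x := by
  simpa using h.trace_mul x 1 D.one_mem

theorem map_star (h : IsTraceExpectation τ D Ψ) (x : M) : Ψ (star x) = star (Ψ x) := by
  refine h.eq_of_trace_mul (D.star_mem' (h.map_mem x)) fun e he => ?_
  have h1 := h.trace_mul x (star e) (D.star_mem' he)
  have h2 := congrArg star h1
  rw [← NCHardy.map_star, ← NCHardy.map_star, star_mul, star_mul, star_star] at h2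
  rw [τ.tracial, h2, τ.tracial]

/-- For y ∈ D, τ(y*Ψ(x)y) = τ(Ψ(y*xy)) = τ(y*xy) ≥ 0, and testing on D suffices. -/
theorem map_nonneg (h : IsTraceExpectation τ D Ψ) (hD : IsClosed (D : Set M)) {x : M} (hx : 0 ≤ x) :
    0 ≤ Ψ x := by
  refine nonneg_of_trace_conj_nonneg τ D hD ?_ (h.map_mem x) fun y hy => ?_
  · rw [IsSelfAdjoint, ← h.map_star, hx.isSelfAdjoint.star_eq]
  · rw [← h.map_mul_mul (D.star_mem' hy) hy, h.trace_eq]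
    exact trace_nonneg τ (star_left_conjugate_nonneg hx y)

/-- Cauchy–Schwarz applied to ‖Ψ(x)‖₂² = τ(Ψ(x)*x). -/
theorem norm_toL2_le (h : IsTraceExpectation τ D Ψ) (x : M) : ‖toL2 τ (Ψ x)‖ ≤ ‖toL2 τ x‖ := by
  have h1 := ofReal_norm_toL2_sq τ (Ψ x)
  rw [h.trace_mul x _ (D.star_mem' (h.map_mem x))] at h1
  have h2 := norm_trace_star_mul_le τ (Ψ x) x
  rw [← h1, Complex.norm_real, Real.norm_of_nonneg (by positivity), pow_two] at h2
  rcases (norm_nonneg (toL2 τ (Ψ x))).eq_or_lt with h0 | h0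
  · rw [← h0]; exact norm_nonneg _
  · exact le_of_mul_le_mul_left h2 h0

theorem tendsto (h : IsTraceExpectation τ D Ψ) {ι : Type*} {l : Filter ι} {x : ι → M} {s : M}
    (hx : Tendsto (fun i => toL2 τ (x i)) l (𝓝 (toL2 τ s))) :
    Tendsto (fun i => toL2 τ (Ψ (x i))) l (𝓝 (toL2 τ (Ψ s))) := by
  rw [tendsto_iff_norm_sub_tendsto_zero] at hx ⊢
  refine squeeze_zero (fun _ => norm_nonneg _) (fun i => ?_) hx
  rw [← toL2_sub, ← toL2_sub, ← map_sub]
  exact h.norm_toL2_le _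

end IsTraceExpectation

end Expectation

/-! ### Increasing nets and normality -/

section Normality

theorem norm_toL2_sq_le (τ : FaithfulNormalTracialState M) {z : M} (hz : 0 ≤ z) :
    ‖toL2 τ z‖ ^ 2 ≤ ‖z‖ * (τ z).re := by
  rw [norm_toL2_sq, hz.isSelfAdjoint.star_eq]
  exact (Complex.re_le_norm _).trans (norm_trace_mul_le τ hz z)

/-- A bounded increasing net in `M` converges to its supremum in `‖·‖₂`. -/
theorem toL2_mem_closure_of_isLUB (τ : FaithfulNormalTracialState M) {S : Set M} {s : M}
    (hne : S.Nonempty) (hdir : DirectedOn (· ≤ ·) S) (hlub : IsLUB S s) :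
    toL2 τ s ∈ closure (toL2 τ '' S) := by
  obtain ⟨x₀, hx₀⟩ := hne
  -- The tail above x₀ is norm bounded, so ‖y − x‖₂² ≤ ‖y − x‖τ(y − x) turns convergence of the
  -- traces into the Cauchy property.
  let ι := {x : M // x ∈ S ∧ x₀ ≤ x}
  have : Nonempty ι := ⟨⟨x₀, hx₀, le_rfl⟩⟩
  have : IsDirectedOrder ι := ⟨fun i j => by
    obtain ⟨z, hz, hiz, hjz⟩ := hdir _ i.2.1 _ j.2.1
    exact ⟨⟨z, hz, i.2.2.trans hiz⟩, hiz, hjz⟩⟩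
  have hle : ∀ i : ι, i.1 ≤ s := fun i => hlub.1 i.2.1
  let f : ι → ℝ := fun i => (τ i.1).re
  have hmono : Monotone f := fun i j hij => (Complex.le_def.1 (trace_mono τ hij)).1
  have hbdd : BddAbove (Set.range f) :=
    ⟨(τ s).re, by rintro _ ⟨i, rfl⟩; exact (Complex.le_def.1 (trace_mono τ (hle i))).1⟩
  have hnorm : ∀ i j : ι, i ≤ j → ‖j.1 - i.1‖ ≤ ‖s - x₀‖ := fun i j hij =>
    CStarAlgebra.norm_le_norm_of_nonneg_of_le (sub_nonneg.2 hij) (sub_le_sub (hle j) i.2.2)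
  have hbound : ∀ i j : ι, i ≤ j → ‖toL2 τ j.1 - toL2 τ i.1‖ ^ 2 ≤ ‖s - x₀‖ * (f j - f i) :=
    fun i j hij => by
      rw [← toL2_sub]
      refine (norm_toL2_sq_le τ (sub_nonneg.2 hij)).trans ?_
      rw [map_sub, Complex.sub_re]
      exact mul_le_mul_of_nonneg_right (hnorm i j hij) (sub_nonneg.2 (hmono hij))
  have hcauchy : Cauchy (map (fun i : ι => toL2 τ i.1) atTop) := by
    rw [Metric.cauchy_iff]
    refine ⟨inferInstance, fun ε hε => ?_⟩
    obtain ⟨i, hi⟩ := exists_lt_of_lt_ciSup (f := f)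
      (show (⨆ i, f i) - (ε / 2) ^ 2 / (‖s - x₀‖ + 1) < ⨆ i, f i from
        sub_lt_self _ (by positivity))
    have hsmall : ∀ j, i ≤ j → ‖toL2 τ j.1 - toL2 τ i.1‖ < ε / 2 := fun j hij => by
      have h1 := hbound i j hij
      have h2 : f j - f i < (ε / 2) ^ 2 / (‖s - x₀‖ + 1) := by
        linarith [le_ciSup hbdd j]
      have h3 : f j - f i ≥ 0 := sub_nonneg.2 (hmono hij)
      rw [lt_div_iff₀ (by positivity)] at h2
      refine lt_of_pow_lt_pow_left₀ 2 (by positivity) ?_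
      nlinarith
    refine ⟨_, image_mem_map (Ici_mem_atTop i), ?_⟩
    rintro _ ⟨j, hj, rfl⟩ _ ⟨k, hk, rfl⟩
    have h1 := hsmall j hj
    have h2 := hsmall k hk
    rw [← dist_eq_norm] at h1 h2
    exact (dist_triangle_right _ _ _).trans_lt (by linarith)
  obtain ⟨v, hv⟩ := CompleteSpace.complete hcauchy
  obtain ⟨t, -, -, rfl⟩ := exists_of_tendsto_toL2 τ (S := Set.univ)
    (@isClosed_univ M (weakStarTopology M)) (l := atTop) (x := fun i : ι => i.1)
    (R := ‖s - x₀‖ + ‖x₀‖) (fun i => by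
      have := hnorm ⟨x₀, hx₀, le_rfl⟩ i i.2.2
      calc ‖i.1‖ = ‖i.1 - x₀ + x₀‖ := by simp
        _ ≤ _ := (norm_add_le _ _).trans (add_le_add_left this _)) (fun _ => trivial) hv
  have hv' : Tendsto (fun i : ι => toL2 τ i.1) atTop (𝓝 (toL2 τ t)) := hv
  have hts : t = s := by
    refine le_antisymm ?_ (hlub.2 fun y hy => ?_)
    · exact le_of_tendsto_toL2 τ hv' tendsto_const_nhds (Eventually.of_forall hle)
    · obtain ⟨z, hz, hyz, hxz⟩ := hdir _ hy _ hx₀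
      exact le_of_tendsto_toL2 τ tendsto_const_nhds hv'
        ((eventually_ge_atTop (⟨z, hz, hxz⟩ : ι)).mono fun i hi => hyz.trans hi)
  rw [← hts]
  exact mem_closure_of_tendsto hv' (Eventually.of_forall fun i => ⟨i.1, i.2.1, rfl⟩)

theorem exists_seq_of_toL2_mem_closure {τ : FaithfulNormalTracialState M} {S : Set M} {s : M}
    (h : toL2 τ s ∈ closure (toL2 τ '' S)) :
    ∃ x : ℕ → M, (∀ n, x n ∈ S) ∧ Tendsto (fun n => toL2 τ (x n)) atTop (𝓝 (toL2 τ s)) := by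
  obtain ⟨y, hy, hlim⟩ := mem_closure_iff_seq_limit.1 h
  choose x hx hxy using hy
  exact ⟨x, hx, hlim.congr fun n => (hxy n).symm⟩

/-- The supremum is a ‖·‖₂-limit of elements of S, Ψ is ‖·‖₂-continuous, and order bounds survive
such limits. -/
theorem IsTraceExpectation.isLUB_image {τ : FaithfulNormalTracialState M} {D : StarSubalgebra ℂ M}
    {Ψ : M →ₗ[ℂ] M} (h : IsTraceExpectation τ D Ψ) (hD : IsClosed (D : Set M)) {S : Set M} {s : M}
    (hne : S.Nonempty) (hdir : DirectedOn (· ≤ ·) S) (hlub : IsLUB S s) :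
    IsLUB (Ψ '' S) (Ψ s) := by
  have hmono : ∀ {x y : M}, x ≤ y → Ψ x ≤ Ψ y := fun {x y} hxy => by
    have := h.map_nonneg hD (sub_nonneg.2 hxy)
    rw [map_sub] at this
    exact sub_nonneg.1 this
  refine ⟨?_, fun u hu => ?_⟩
  · rintro _ ⟨x, hx, rfl⟩
    exact hmono (hlub.1 hx)
  · obtain ⟨x, hx, hlim⟩ := exists_seq_of_toL2_mem_closure
      (toL2_mem_closure_of_isLUB τ hne hdir hlub)
    exact le_of_tendsto_toL2 τ (h.tendsto hlim) tendsto_const_nhds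
      (Eventually.of_forall fun n => hu ⟨x n, hx n, rfl⟩)

end Normality

/-! ### The diagonal, and uniqueness of its expectation -/

section Diagonal

theorem mem_diagonal {A : Subalgebra ℂ M} {x : M} : x ∈ diagonal A ↔ x ∈ A ∧ star x ∈ A := by
  rw [diagonal, Algebra.mem_inf, Subalgebra.mem_star_iff]

/-- The diagonal `A ∩ A*` as a `*`-subalgebra. -/
noncomputable def starDiagonal (A : Subalgebra ℂ M) : StarSubalgebra ℂ M where
  toSubalgebra := diagonal A
  star_mem' {x} hx := by
    have := mem_diagonal.1 hx
    exact mem_diagonal.2 ⟨this.2, by rw [star_star]; exact this.1⟩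

theorem mem_starDiagonal {A : Subalgebra ℂ M} {x : M} :
    x ∈ starDiagonal A ↔ x ∈ A ∧ star x ∈ A := mem_diagonal

theorem weakStarContinuous_star (M : VonNeumannAlgebra H) :
    @Continuous M M (weakStarTopology M) (weakStarTopology M) star := by
  rw [weakStarTopology_eq, continuous_iInf_rng]
  intro p
  rw [continuous_induced_rng, ← weakStarTopology_eq]
  have h : (vecFun M p.1 p.2 : M → ℂ) ∘ star = star ∘ (vecFun M p.2 p.1 : M → ℂ) := by
    ext x
    simp only [Function.comp_apply, vecFun_apply]
    rw [← inner_rep_left]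
    exact (inner_conj_symm _ _).symm
  rw [h]
  let _ := weakStarTopology M
  exact continuous_star.comp (weakStarContinuous_vecFun p.2 p.1)

theorem weakStar_isClosed_starDiagonal {A : Subalgebra ℂ M}
    (hA : @IsClosed M (weakStarTopology M) (A : Set M)) :
    @IsClosed M (weakStarTopology M) (starDiagonal A : Set M) := by
  have h : (starDiagonal A : Set M) = (A : Set M) ∩ star ⁻¹' (A : Set M) := by
    ext x
    exact mem_starDiagonal
  rw [h]
  let _ := weakStarTopology M
  exact hA.inter (hA.preimage (weakStarContinuous_star M))

variable {τ : FaithfulNormalTracialState M} {A : Subalgebra ℂ M} {Ψ : M →ₗ[ℂ] M}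

theorem IsTraceExpectation.isCanonicalExpectation
    (hA : @IsClosed M (weakStarTopology M) (A : Set M))
    (h : IsTraceExpectation τ (starDiagonal A) Ψ) : IsCanonicalExpectation τ A Ψ where
  map_mem := h.map_mem
  map_eq_self _ hd := h.map_eq_self hd
  map_mul_mul _ hd _ he x := h.map_mul_mul hd he x
  map_nonneg _ hx :=
    h.map_nonneg (isClosed_of_weakStar_isClosed τ (weakStar_isClosed_starDiagonal hA)) hx
  faithful x hx := τ.faithful x (by rw [← h.trace_eq, hx, map_zero])
  normal _ _ hne hdir hlub :=
    h.isLUB_image (isClosed_of_weakStar_isClosed τ (weakStar_isClosed_starDiagonal hA)) hne hdir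
      hlub
  trace_eq := h.trace_eq

/-- τ(eΨ(x)) = τ(Ψ(ex)) = τ(ex): positivity, faithfulness and normality play no part in uniqueness.
-/
theorem IsCanonicalExpectation.isTraceExpectation (h : IsCanonicalExpectation τ A Ψ) :
    IsTraceExpectation τ (starDiagonal A) Ψ where
  map_mem := h.map_mem
  trace_mul x e he := by
    have := h.map_mul_mul e he 1 (diagonal A).one_mem x
    rw [mul_one, mul_one] at this
    rw [← this, h.trace_eq]

theorem IsTraceExpectation.unique {D : StarSubalgebra ℂ M} {Ψ' : M →ₗ[ℂ] M}
    (h : IsTraceExpectation τ D Ψ) (h' : IsTraceExpectation τ D Ψ') : Ψ' = Ψ :=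
  LinearMap.ext fun x => h'.eq_of_trace_mul (h.map_mem x) (h.trace_mul x)

/-- For e in the diagonal, τ(eΦ(a)) = τ(Φ(ea)) = τ(ea), which characterises Ψ(a). -/
theorem IsTracialProjection.eq_expectation {Φ : A →ₐ[ℂ] M} (hΦ : IsTracialProjection τ A Φ)
    (h : IsTraceExpectation τ (starDiagonal A) Ψ) (a : A) : Φ a = Ψ a := by
  refine (h.eq_of_trace_mul (hΦ.map_mem a) fun e he => ?_).symm
  have heA : e ∈ A := (mem_starDiagonal.1 he).1
  have h1 : Φ ⟨e, heA⟩ = e := hΦ.map_eq_self ⟨e, heA⟩ he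
  nth_rw 1 [← h1]
  rw [← map_mul, hΦ.trace_eq]
  rfl

end Diagonal

/-! ### A_∞ is a tracial subalgebra with the same diagonal -/

section AInfty

variable {τ : FaithfulNormalTracialState M} {A : Subalgebra ℂ M} {Ψ : M →ₗ[ℂ] M}

theorem mem_AInfty_of_tendsto {x : M} {a : ℕ → M} (ha : ∀ n, a n ∈ AInfty τ A)
    (h : Tendsto (fun n => toL2 τ (a n)) atTop (𝓝 (toL2 τ x))) : x ∈ AInfty τ A :=
  isClosed_closure.mem_of_tendsto h (Eventually.of_forall ha)

theorem subset_AInfty : (A : Set M) ⊆ AInfty τ A := fun a ha => subset_closure ⟨a, ha, rfl⟩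

theorem exists_seq_of_mem_AInfty {x : M} (hx : x ∈ AInfty τ A) : ∃ a : ℕ → M,
    (∀ n, a n ∈ A) ∧ Tendsto (fun n => toL2 τ (a n)) atTop (𝓝 (toL2 τ x)) :=
  exists_seq_of_toL2_mem_closure hx

variable (τ A) in
/-- The algebra `[A]₂ ∩ M`. -/
noncomputable def aInfty : Subalgebra ℂ M where
  carrier := AInfty τ A
  mul_mem' {x y} hx hy := by
    obtain ⟨a, ha, hax⟩ := exists_seq_of_mem_AInfty hx
    obtain ⟨b, hb, hby⟩ := exists_seq_of_mem_AInfty hy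
    -- Multiplication by a fixed element is ‖·‖₂-continuous, so the limit is taken in one factor at
    -- a time.
    refine mem_AInfty_of_tendsto (fun n => ?_) (tendsto_toL2_mul_right τ y hax)
    exact mem_AInfty_of_tendsto (fun m => subset_AInfty (A.mul_mem (ha n) (hb m)))
      (tendsto_toL2_mul_left τ (a n) hby)
  add_mem' {x y} hx hy := by
    obtain ⟨a, ha, hax⟩ := exists_seq_of_mem_AInfty hx
    obtain ⟨b, hb, hby⟩ := exists_seq_of_mem_AInfty hy
    refine mem_AInfty_of_tendsto (fun n => subset_AInfty (A.add_mem (ha n) (hb n))) ?_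
    simpa only [toL2_add] using hax.add hby
  algebraMap_mem' c := subset_AInfty (A.algebraMap_mem c)

theorem le_aInfty : A ≤ aInfty τ A := subset_AInfty

/-- A_∞ is the common kernel of the weak* continuous functionals ⟨v, ·⟩ with v ⊥ [A]₂. -/
theorem weakStar_isClosed_aInfty : @IsClosed M (weakStarTopology M) (aInfty τ A : Set M) := by
  let Y : Submodule ℂ (L2 τ) := (A.toSubmodule.map (toL2Lin τ)).topologicalClosure
  have : CompleteSpace Y := (Submodule.isClosed_topologicalClosure _).completeSpace_coe
  have h : (aInfty τ A : Set M) = ⋂ v : Yᗮ, {x | inner ℂ (v : L2 τ) (toL2 τ x) = 0} := by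
    ext x
    have h1 : x ∈ aInfty τ A ↔ toL2 τ x ∈ Y := Iff.rfl
    rw [SetLike.mem_coe, h1, ← Submodule.orthogonal_orthogonal Y, Submodule.mem_orthogonal]
    simp
  rw [h]
  let _ := weakStarTopology M
  exact isClosed_iInter fun v =>
    isClosed_eq (weakStarContinuous_inner_toL2 τ (v : L2 τ)) continuous_const

theorem expectation_map_mul (hA : ∃ Φ : A →ₐ[ℂ] M, IsTracialProjection τ A Φ)
    (h : IsTraceExpectation τ (starDiagonal A) Ψ) {x y : M} (hx : x ∈ AInfty τ A)
    (hy : y ∈ AInfty τ A) : Ψ (x * y) = Ψ x * Ψ y := by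
  obtain ⟨Φ, hΦ⟩ := hA
  have h1 : ∀ a ∈ A, ∀ b ∈ A, Ψ (a * b) = Ψ a * Ψ b := fun a ha b hb => by
    have := map_mul Φ ⟨a, ha⟩ ⟨b, hb⟩
    rw [hΦ.eq_expectation h, hΦ.eq_expectation h, hΦ.eq_expectation h] at this
    exact this
  obtain ⟨a, ha, hax⟩ := exists_seq_of_mem_AInfty hx
  obtain ⟨b, hb, hby⟩ := exists_seq_of_mem_AInfty hy
  have h2 : ∀ n, Ψ (a n * y) = Ψ (a n) * Ψ y := fun n => by
    refine toL2_injective τ (tendsto_nhds_unique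
      (h.tendsto (tendsto_toL2_mul_left τ (a n) hby)) ?_)
    simp only [h1 _ (ha n) _ (hb _)]
    exact tendsto_toL2_mul_left τ _ (h.tendsto hby)
  refine toL2_injective τ (tendsto_nhds_unique (h.tendsto (tendsto_toL2_mul_right τ y hax)) ?_)
  simp only [h2]
  exact tendsto_toL2_mul_right τ _ (h.tendsto hax)

theorem diagonal_aInfty (hA : ∃ Φ : A →ₐ[ℂ] M, IsTracialProjection τ A Φ)
    (h : IsTraceExpectation τ (starDiagonal A) Ψ) : diagonal (aInfty τ A) = diagonal A := by
  apply le_antisymm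
  · intro x hx
    obtain ⟨hx1, hx2⟩ := mem_diagonal.1 hx
    have hΨ : Ψ x ∈ diagonal A := h.map_mem x
    obtain ⟨h3, h4⟩ := mem_diagonal.1 hΨ
    have h1 : x - Ψ x ∈ aInfty τ A := sub_mem hx1 (le_aInfty h3)
    have h2 : star (x - Ψ x) ∈ aInfty τ A := by
      rw [star_sub]; exact sub_mem hx2 (le_aInfty h4)
    have h5 : Ψ (star (x - Ψ x) * (x - Ψ x)) = 0 := by
      rw [expectation_map_mul hA h h2 h1, map_sub, h.map_eq_self hΨ, sub_self, mul_zero]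
    have h6 : x - Ψ x = 0 := τ.faithful _ (by rw [← h.trace_eq, h5, map_zero])
    rw [sub_eq_zero.1 h6]
    exact hΨ
  · intro x hx
    obtain ⟨hx1, hx2⟩ := mem_diagonal.1 hx
    exact mem_diagonal.2 ⟨le_aInfty hx1, le_aInfty hx2⟩

theorem isTracialSubalgebra_aInfty (hA : ∃ Φ : A →ₐ[ℂ] M, IsTracialProjection τ A Φ)
    (h : IsTraceExpectation τ (starDiagonal A) Ψ) : IsTracialSubalgebra τ (aInfty τ A) where
  weakStar_closed := weakStar_isClosed_aInfty
  exists_projection := by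
    let Φ : aInfty τ A →ₐ[ℂ] M := AlgHom.ofLinearMap (Ψ.comp (aInfty τ A).toSubmodule.subtype)
      (h.map_eq_self (starDiagonal A).one_mem)
      (fun x y => expectation_map_mul hA h x.2 y.2)
    refine ⟨Φ, fun a => ?_, fun d hd => ?_, fun a => h.trace_eq a⟩
    · rw [diagonal_aInfty hA h]
      exact h.map_mem a
    · rw [diagonal_aInfty hA h] at hd
      exact h.map_eq_self hd

end AInfty

/-! ### Closures of orbits -/

section ClosedOrbits

theorem mem_closure_orbit_iff {N : Submodule ℂ M} {y w : Ampl H} :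
    w ∈ (orbit N y).topologicalClosure ↔
      ∀ z, (∀ x ∈ N, inner ℂ (rep M x y) z = 0) → inner ℂ w z = 0 := by
  have : CompleteSpace (orbit N y).topologicalClosure :=
    (Submodule.isClosed_topologicalClosure _).completeSpace_coe
  rw [← Submodule.orthogonal_orthogonal (orbit N y).topologicalClosure,
    Submodule.orthogonal_closure, Submodule.mem_orthogonal']
  refine forall_congr' fun z => imp_congr_left ?_
  rw [Submodule.mem_orthogonal]
  exact ⟨fun h x hx => h _ (rep_mem_orbit hx y), fun h u hu => by
    obtain ⟨x, hx, rfl⟩ := mem_orbit.1 hu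
    exact h x hx⟩

theorem exists_seq_of_mem_closure_orbit {N : Submodule ℂ M} {y w : Ampl H}
    (h : w ∈ (orbit N y).topologicalClosure) : ∃ x : ℕ → M, (∀ n, x n ∈ N) ∧
      Tendsto (fun n => rep M (x n) y) atTop (𝓝 w) := by
  have h' : w ∈ closure (orbit N y : Set (Ampl H)) := h
  obtain ⟨u, hu, hlim⟩ := mem_closure_iff_seq_limit.1 h'
  choose x hx hxu using fun n => mem_orbit.1 (hu n)
  exact ⟨x, hx, hlim.congr fun n => (hxu n).symm⟩

theorem mem_closure_orbit_of_tendsto {N : Submodule ℂ M} {y w : Ampl H} {x : ℕ → M}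
    (hx : ∀ n, x n ∈ N) (h : Tendsto (fun n => rep M (x n) y) atTop (𝓝 w)) :
    w ∈ (orbit N y).topologicalClosure :=
  mem_closure_of_tendsto (s := (orbit N y : Set (Ampl H))) h
    (Eventually.of_forall fun n => rep_mem_orbit (hx n) y)

theorem rep_mem_closure_orbit {N N' : Submodule ℂ M} {y z : Ampl H} {c : M}
    (hc : ∀ x ∈ N, c * x ∈ N') (hz : z ∈ (orbit N y).topologicalClosure) :
    rep M c z ∈ (orbit N' y).topologicalClosure := by
  obtain ⟨x, hx, hlim⟩ := exists_seq_of_mem_closure_orbit hz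
  refine mem_closure_orbit_of_tendsto (x := fun n => c * x n) (fun n => hc _ (hx n)) ?_
  simpa only [map_mul, mul_apply_eq_comp, Function.comp_def] using
    ((rep M c).continuous.tendsto z).comp hlim

theorem closure_orbit_le {N : Submodule ℂ M} {y : Ampl H} {S : Submodule ℂ (Ampl H)}
    (h : ∀ x ∈ N, rep M x y ∈ S.topologicalClosure) :
    (orbit N y).topologicalClosure ≤ S.topologicalClosure := by
  refine Submodule.topologicalClosure_minimal _ ?_ S.isClosed_topologicalClosure
  intro u hu
  obtain ⟨x, hx, rfl⟩ := mem_orbit.1 hu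
  exact h x hx

/-- The orthogonal decomposition of a vector with respect to the closure of an orbit. -/
theorem exists_orbit_decomposition (N : Submodule ℂ M) (y z : Ampl H) :
    ∃ p ∈ (orbit N y).topologicalClosure, ∀ u ∈ (orbit N y).topologicalClosure,
      inner ℂ u (z - p) = 0 := by
  have : CompleteSpace (orbit N y).topologicalClosure :=
    (Submodule.isClosed_topologicalClosure _).completeSpace_coe
  refine ⟨(orbit N y).topologicalClosure.starProjection z,
    Submodule.starProjection_apply_mem _ _, fun u hu => ?_⟩
  exact (Submodule.mem_orthogonal _ _).1
    ((orbit N y).topologicalClosure.sub_starProjection_mem_orthogonal z) u hu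

theorem rep_mem_closure_orbit_self {N : Submodule ℂ M} (y : Ampl H) {x : M} (hx : x ∈ N) :
    rep M x y ∈ (orbit N y).topologicalClosure :=
  Submodule.le_topologicalClosure _ (rep_mem_orbit hx y)

theorem ext_on_orbit {W : Type*} [NormedAddCommGroup W] [NormedSpace ℂ W] {N : Submodule ℂ M}
    {y : Ampl H} {F G : Ampl H →L[ℂ] W} (h₁ : ∀ x ∈ N, F (rep M x y) = G (rep M x y))
    (h₂ : ∀ z, (∀ x ∈ N, inner ℂ (rep M x y) z = 0) → F z = G z) : F = G := by
  ext z
  obtain ⟨p, hp, hpz⟩ := exists_orbit_decomposition N y z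
  have h3 : F p = G p := by
    obtain ⟨x, hx, hlim⟩ := exists_seq_of_mem_closure_orbit hp
    refine tendsto_nhds_unique ((F.continuous.tendsto p).comp hlim) ?_
    exact ((G.continuous.tendsto p).comp hlim).congr fun n => (h₁ _ (hx n)).symm
  have h4 := h₂ (z - p) fun x hx => hpz _ (rep_mem_closure_orbit_self y hx)
  rw [map_sub, map_sub, h3] at h4
  exact sub_left_inj.1 h4

end ClosedOrbits

/-! ### Closability and trace vectors -/

section Closability

variable (τ : FaithfulNormalTracialState M)

/-- The truncation `(1 + d d*)⁻¹` of `d`. -/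
theorem exists_truncation (d : M) : ∃ f : M, IsSelfAdjoint f ∧ ‖f‖ ≤ 1 ∧ ‖1 - f‖ ≤ 1 ∧
    ‖f * d‖ ≤ 1 ∧ ‖toL2 τ (1 - f)‖ ≤ ‖toL2 τ d‖ := by
  set a : M := d * star d with ha
  have ha0 : 0 ≤ a := mul_star_self_nonneg d
  have hsp : ∀ t ∈ spectrum ℝ a, 0 ≤ t := fun t ht => spectrum_nonneg_of_nonneg ha0 ht
  let g : ℝ → ℝ := fun t => (1 + |t|)⁻¹
  have hg0 : ∀ t, 0 < g t := fun t => by positivity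
  have hg1 : ∀ t, g t ≤ 1 := fun t => inv_le_one_of_one_le₀ (by linarith [abs_nonneg t])
  have hgt : ∀ t, g t * (1 + |t|) = 1 := fun t => inv_mul_cancel₀ (by positivity)
  have hgc : Continuous g := Continuous.inv₀ (by fun_prop) fun t => by positivity
  have hgc1 : Continuous fun t => 1 - g t := continuous_const.sub hgc
  have hgc2 : Continuous fun t => t * g t := continuous_id.mul hgc
  set f : M := cfc g a with hf
  have hfs : IsSelfAdjoint f := cfc_predicate _ _
  have h1f : 1 - f = cfc (fun t => 1 - g t) a := by
    rw [cfc_sub (fun _ => (1 : ℝ)) g a continuous_const.continuousOn hgc.continuousOn,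
      cfc_const_one ℝ a]
  have h1fs : star (1 - f) = 1 - f := by rw [star_sub, star_one, hfs.star_eq]
  refine ⟨f, hfs, ?_, ?_, ?_, ?_⟩
  · refine norm_cfc_le zero_le_one fun t _ => ?_
    rw [Real.norm_of_nonneg (hg0 t).le]
    exact hg1 t
  · rw [h1f]
    refine norm_cfc_le zero_le_one fun t _ => ?_
    rw [Real.norm_of_nonneg (sub_nonneg.2 (hg1 t))]
    linarith [hg0 t]
  · have h1 : ‖f * d‖ * ‖f * d‖ = ‖f * (a * f)‖ := by
      rw [← CStarRing.norm_self_mul_star, star_mul, hfs.star_eq, ha]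
      noncomm_ring
    have h2 : f * (a * f) = cfc (fun t => g t * (t * g t)) a := by
      rw [cfc_mul _ _ a hgc.continuousOn hgc2.continuousOn,
        cfc_mul (fun t => t) _ a continuousOn_id hgc.continuousOn, cfc_id' ℝ a]
    have h3 : ‖f * (a * f)‖ ≤ 1 := by
      rw [h2]
      refine norm_cfc_le zero_le_one fun t ht => ?_
      have ht0 := hsp t ht
      have h4 := hgt t
      rw [abs_of_nonneg ht0] at h4
      have h5 := hg0 t
      rw [Real.norm_of_nonneg (by positivity)]
      nlinarith [hg1 t]
    nlinarith [norm_nonneg (f * d)]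
  · refine le_of_sq_le_sq ?_ (norm_nonneg _)
    rw [← norm_toL2_star τ d, norm_toL2_sq, norm_toL2_sq, star_star, h1fs]
    refine (Complex.le_def.1 (trace_mono τ ?_)).1
    rw [← ha, h1f, ← cfc_mul _ _ a hgc1.continuousOn hgc1.continuousOn]
    conv_rhs => rw [← cfc_id' ℝ a]
    refine cfc_mono (fun t ht => ?_) (hgc1.mul hgc1).continuousOn continuousOn_id
    have ht0 := hsp t ht
    have h4 := hgt t
    rw [abs_of_nonneg ht0] at h4
    have h5 := hg0 t
    have h6 := hg1 t
    have h7 : 1 - g t = t * g t := by linarith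
    rw [h7]
    nlinarith [mul_nonneg ht0 h5.le]

/-- The map `x ↦ x y` is closable for `‖·‖₂`. -/
theorem eq_zero_of_tendsto_rep {d : ℕ → M} {y z : Ampl H}
    (hd : Tendsto (fun n => ‖toL2 τ (d n)‖) atTop (𝓝 0))
    (hz : Tendsto (fun n => rep M (d n) y) atTop (𝓝 z)) : z = 0 := by
  -- The products f d are bounded and tend to 0 in ‖·‖₂, so f d y → 0 weakly, while f z → z in norm.
  -- Hence ⟨f z, d y⟩ = ⟨z, f d y⟩ tends both to ⟨z, z⟩ and to 0.
  choose f hfs hf1 hf1' hfd hfτ using fun n => exists_truncation τ (d n)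
  have h1 : Tendsto (fun n => inner ℂ z (rep M (f n * d n) y)) atTop (𝓝 0) := by
    refine tendsto_vecFun_of_tendsto_toL2_zero τ hfd ?_ z y
    refine squeeze_zero (fun _ => norm_nonneg _) (fun n => ?_) hd
    exact (norm_toL2_mul_le τ _ _).trans (mul_le_of_le_one_left (norm_nonneg _) (hf1 n))
  have h2 : Tendsto (fun n => ‖rep M (1 - f n) z‖ ^ 2) atTop (𝓝 0) := by
    have h3 : Tendsto (fun n => inner ℂ z (rep M ((1 - f n) * (1 - f n)) z)) atTop (𝓝 0) := by
      refine tendsto_vecFun_of_tendsto_toL2_zero τ (R := 1) (fun n => ?_) ?_ z z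
      · exact (norm_mul_le _ _).trans (mul_le_one₀ (hf1' n) (norm_nonneg _) (hf1' n))
      · refine squeeze_zero (fun _ => norm_nonneg _) (fun n => ?_) hd
        exact (norm_toL2_mul_le τ _ _).trans
          ((mul_le_of_le_one_left (norm_nonneg _) (hf1' n)).trans (hfτ n))
    have h4 := h3.norm
    rw [norm_zero] at h4
    refine h4.congr fun n => ?_
    rw [map_mul, mul_apply_eq_comp, ← inner_rep_star_left, star_sub, star_one, (hfs n).star_eq,
      inner_self_eq_norm_sq_to_K]
    simp
  have h3 : Tendsto (fun n => rep M (f n) z) atTop (𝓝 z) := by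
    rw [tendsto_iff_norm_sub_tendsto_zero]
    have := h2.sqrt
    simp only [Real.sqrt_sq (norm_nonneg _), Real.sqrt_zero] at this
    refine this.congr fun n => ?_
    rw [map_sub, map_one, norm_sub_rev]
    rfl
  have h4 := h3.inner (𝕜 := ℂ) hz
  have h5 : inner ℂ z z = 0 := tendsto_nhds_unique h4 (h1.congr fun n => by
    rw [map_mul, mul_apply_eq_comp, ← inner_rep_star_left, (hfs n).star_eq])
  exact inner_self_eq_zero.1 h5

theorem exists_positive_sqrt {K : Type*} [NormedAddCommGroup K] [InnerProductSpace ℂ K]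
    [CompleteSpace K] {T : K →L[ℂ] K} (hT : 0 ≤ T) :
    ∃ R : K →L[ℂ] K, R * R = T ∧ star R = R ∧ ∀ S, Commute T S → Commute R S :=
  ⟨CFC.sqrt T, CFC.sqrt_mul_sqrt_self T hT, (CFC.sqrt_nonneg T).isSelfAdjoint.star_eq,
    fun _ hS => hS.cfcₙ_nnreal _⟩

/-- If `‖x‖₂ ≤ ‖x y‖` on a `*`-subalgebra `D`, then the closure of `D y` is the closure of `D t`
for a trace vector `t`. -/
theorem exists_trace_vector (D : StarSubalgebra ℂ M) (y : Ampl H)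
    (hy : ∀ x ∈ D, ‖toL2 τ x‖ ≤ ‖rep M x y‖) :
    ∃ t ∈ (orbit D.toSubalgebra.toSubmodule y).topologicalClosure,
      (∀ x ∈ D, inner ℂ t (rep M x t) = τ x) ∧
      y ∈ (orbit D.toSubalgebra.toSubmodule t).topologicalClosure := by
  obtain ⟨V, hV, hV0⟩ := exists_extension τ D.toSubalgebra.toSubmodule y hy
  replace hV : ∀ x ∈ D, V (rep M x y) = toL2 τ x := hV
  replace hV0 : ∀ z, (∀ x ∈ D, inner ℂ (rep M x y) z = 0) → V z = 0 := hV0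
  have hperp : ∀ x ∈ D, ∀ z, (∀ x' ∈ D, inner ℂ (rep M x' y) z = 0) →
      ∀ x' ∈ D, inner ℂ (rep M x' y) (rep M x z) = 0 := fun x hx z hz x' hx' => by
    rw [← inner_rep_star_left, ← mul_apply_eq_comp, ← map_mul]
    exact hz _ (D.mul_mem (D.star_mem' hx) hx')
  -- T = V*V commutes with D, hence so does R = √T. The trace vector is Ry: ⟨Ry, xRy⟩ = ⟨Vy, V(xy)⟩
  -- = ⟨1, x⟩ = τ(x).
  let T : Ampl H →L[ℂ] Ampl H := (ContinuousLinearMap.adjoint V).comp V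
  have hTi : ∀ u z, inner ℂ u (T z) = inner ℂ (V u) (V z) := fun u z =>
    ContinuousLinearMap.adjoint_inner_right V u (V z)
  have hT0 : 0 ≤ T := by
    rw [ContinuousLinearMap.nonneg_iff_isPositive]
    exact ContinuousLinearMap.isPositive_adjoint_comp_self V
  have hcomm : ∀ x ∈ D, Commute T (rep M x) := fun x hx => by
    refine ext_on_orbit (N := D.toSubalgebra.toSubmodule) (y := y) (fun x' hx' => ?_)
      (fun z hz => ?_)
    · refine ext_inner_right ℂ fun u => ?_
      have key : ((innerSL ℂ (toL2 τ (x * x'))).comp V) =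
          ((innerSL ℂ (toL2 τ x')).comp (V.comp (rep M (star x)))) := by
        refine ext_on_orbit (N := D.toSubalgebra.toSubmodule) (y := y) (fun u' hu' => ?_)
          (fun z hz => ?_)
        · have h1 : rep M (star x) (rep M u' y) = rep M (star x * u') y := by
            rw [map_mul, mul_apply_eq_comp]
          simp only [ContinuousLinearMap.comp_apply, innerSL_apply_apply, h1]
          rw [hV _ hu', hV _ (D.mul_mem (D.star_mem' hx) hu'), inner_toL2, inner_toL2, star_mul,
            mul_assoc]
        · simp only [ContinuousLinearMap.comp_apply, innerSL_apply_apply]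
          rw [hV0 z hz, hV0 _ (hperp _ (D.star_mem' hx) z hz)]
          simp
      have key' := DFunLike.congr_fun key u
      simp only [ContinuousLinearMap.comp_apply, innerSL_apply_apply] at key'
      rw [mul_apply_eq_comp, mul_apply_eq_comp, inner_rep_left, ← inner_conj_symm, hTi,
        inner_conj_symm, ← mul_apply_eq_comp (rep M x), ← map_mul, hV _ (D.mul_mem hx hx'), key',
        ← hV _ hx', ← inner_conj_symm, ← hTi, inner_conj_symm]
    · rw [mul_apply_eq_comp, mul_apply_eq_comp]
      change (ContinuousLinearMap.adjoint V) (V _) = rep M x ((ContinuousLinearMap.adjoint V) (V z))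
      rw [hV0 z hz, hV0 _ (hperp x hx z hz), map_zero, map_zero]
  obtain ⟨R, hRR, hRstar, hRT⟩ := exists_positive_sqrt hT0
  have hRs : ∀ u z, inner ℂ (R u) z = inner ℂ u (R z) := fun u z => by
    rw [← ContinuousLinearMap.adjoint_inner_right, ← ContinuousLinearMap.star_eq_adjoint, hRstar]
  have hRcomm : ∀ x ∈ D, ∀ z, R (rep M x z) = rep M x (R z) := fun x hx z => by
    have h1 : Commute R (rep M x) := hRT _ (hcomm x hx)
    exact DFunLike.congr_fun h1.eq z
  have hRRi : ∀ u z, inner ℂ (R u) (R z) = inner ℂ (V u) (V z) := fun u z => by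
    rw [hRs, ← hTi, ← hRR, mul_apply_eq_comp]
  have hRV : ∀ z, V z = 0 → R z = 0 := fun z hz => by
    have := hRRi z z
    rwa [hz, inner_zero_left, inner_self_eq_zero] at this
  have hVR : ∀ z, R z = 0 → V z = 0 := fun z hz => by
    have := hRRi z z
    rw [hz, inner_zero_left] at this
    exact inner_self_eq_zero.1 this.symm
  have hy1 : rep M 1 y = y := by rw [map_one, one_apply_eq_self]
  refine ⟨R y, ?_, fun x hx => ?_, ?_⟩
  · refine mem_closure_orbit_iff.2 fun z hz => ?_
    rw [hRs, hRV z (hV0 z hz), inner_zero_right]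
  · have h1 : V y = toL2 τ 1 := by rw [← hV 1 D.one_mem, hy1]
    rw [← hRcomm x hx, hRRi, hV x hx, h1, inner_toL2, star_one, one_mul]
  · refine mem_closure_orbit_iff.2 fun z hz => ?_
    -- If z ⊥ DRy then Rz ⊥ Dy, so V(Rz) = 0 and, R being self-adjoint, Rz = 0 and Vz = 0. By
    -- closability V has no kernel in the closure of Dy, so z ⊥ Dy.
    have h1 : V (R z) = 0 := hV0 _ fun x hx => by
      rw [← hRs, hRcomm x hx]
      exact hz x hx
    have h2 : R (R z) = 0 := by
      have h3 : R (R (R z)) = 0 := hRV _ (by rw [h1]) |> fun h => by rw [h, map_zero]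
      have h4 := hRs (R z) (R (R z))
      rw [h3, inner_zero_right] at h4
      exact inner_self_eq_zero.1 h4
    have h3 : V z = 0 := hVR z (by
      have h4 := hRs z (R z)
      rw [h2, inner_zero_right] at h4
      exact inner_self_eq_zero.1 h4)
    obtain ⟨p, hp, hpz⟩ := exists_orbit_decomposition D.toSubalgebra.toSubmodule y z
    have h4 : V p = 0 := by
      have := hV0 (z - p) fun x hx => hpz _ (rep_mem_closure_orbit_self y hx)
      rw [map_sub, h3, zero_sub, neg_eq_zero] at this
      exact this
    obtain ⟨x, hx, hlim⟩ := exists_seq_of_mem_closure_orbit hp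
    have h5 : p = 0 := by
      refine eq_zero_of_tendsto_rep τ ?_ hlim
      have := ((V.continuous.tendsto p).comp hlim).norm
      rw [h4, norm_zero] at this
      refine this.congr fun n => ?_
      rw [Function.comp_apply, hV _ (hx n)]
    have h6 := hpz y (by
      have := rep_mem_closure_orbit_self (N := D.toSubalgebra.toSubmodule) y D.one_mem
      rwa [hy1] at this)
    rwa [h5, sub_zero] at h6

end Closability

/-! ### Weak* density of A + A* and the equality A = A_∞ -/

section Density

variable {τ : FaithfulNormalTracialState M} {A : Subalgebra ℂ M} {Ψ : M →ₗ[ℂ] M}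

theorem eq_of_weakStar_dense
    (hA : @Dense M (weakStarTopology M) {x : M | ∃ a ∈ A, ∃ b ∈ A, x = a + star b})
    {f g : M →ₗ[ℂ] ℂ} (hf : WeakStarContinuous f) (hg : WeakStarContinuous g)
    (h₁ : ∀ a ∈ A, f a = g a) (h₂ : ∀ a ∈ A, f (star a) = g (star a)) (x : M) : f x = g x := by
  let _ := weakStarTopology M
  have hf' : Continuous f := hf
  have hg' : Continuous g := hg
  refine congrFun (Continuous.ext_on hA hf' hg' ?_) x
  rintro _ ⟨a, ha, b, hb, rfl⟩
  rw [map_add, map_add, h₁ a ha, h₂ b hb]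

theorem norm_rep_eq_of_trace {N : StarSubalgebra ℂ M} {w : Ampl H}
    (hw : ∀ x ∈ N, inner ℂ w (rep M x w) = τ x) {x : M} (hx : x ∈ N) :
    ‖rep M x w‖ = ‖toL2 τ x‖ := by
  rw [← sq_eq_sq₀ (norm_nonneg _) (norm_nonneg _), norm_toL2_sq,
    ← hw _ (N.mul_mem (N.star_mem' hx) hx), map_mul, mul_apply_eq_comp, ← inner_rep_left,
    inner_self_eq_norm_sq_to_K]
  norm_cast

/-- If `t` and `w` are trace vectors for `M` and `w` is in the closure of `M t`, then `t` is in the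
closure of `M w`: an isometry in a finite von Neumann algebra is unitary. -/
theorem mem_closure_orbit_symm {t w : Ampl H}
    (ht : ∀ x, inner ℂ t (rep M x t) = τ x) (hw : ∀ x, inner ℂ w (rep M x w) = τ x)
    (hwt : w ∈ (orbit (⊤ : Submodule ℂ M) t).topologicalClosure) :
    t ∈ (orbit (⊤ : Submodule ℂ M) w).topologicalClosure := by
  obtain ⟨x, -, hlim⟩ := exists_seq_of_mem_closure_orbit hwt
  refine mem_closure_orbit_of_tendsto (x := fun n => star (x n)) (fun _ => trivial) ?_
  -- In the expanded squares, ‖z*w‖ = ‖z‖₂ = ‖zt‖ by traciality, ‖t‖ = ‖w‖, and the cross terms are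
  -- conjugate.
  have key : ∀ z : M, ‖rep M (star z) w - t‖ = ‖rep M z t - w‖ := fun z => by
    have e1 : ‖rep M (star z) w‖ = ‖toL2 τ z‖ := by
      rw [norm_rep_eq_of_trace (N := ⊤) (fun x _ => hw x) trivial, norm_toL2_star]
    have e2 : ‖rep M z t‖ = ‖toL2 τ z‖ :=
      norm_rep_eq_of_trace (N := ⊤) (fun x _ => ht x) trivial
    have e3 : ‖t‖ = ‖w‖ := by
      have h1 := norm_rep_eq_of_trace (N := ⊤) (fun x _ => ht x) (x := 1) trivial
      have h2 := norm_rep_eq_of_trace (N := ⊤) (fun x _ => hw x) (x := 1) trivial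
      rw [map_one, one_apply_eq_self] at h1 h2
      rw [h1, h2]
    rw [← sq_eq_sq₀ (norm_nonneg _) (norm_nonneg _), @norm_sub_sq ℂ, @norm_sub_sq ℂ, e1, e2, e3,
      inner_rep_star_left, ← inner_conj_symm w, RCLike.conj_re]
  rw [tendsto_iff_norm_sub_tendsto_zero] at hlim ⊢
  exact hlim.congr fun n => (key _).symm

/-- Splitting a = Ψ(a) + (a − Ψ(a)) gives the value τ(a) on A; conjugation handles A*, and density
the rest. -/
theorem trace_vector_of_wandering
    (hA : @Dense M (weakStarTopology M) {x : M | ∃ a ∈ A, ∃ b ∈ A, x = a + star b})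
    (h : IsTraceExpectation τ (starDiagonal A) Ψ) {w : Ampl H}
    (hD : ∀ d ∈ starDiagonal A, inner ℂ w (rep M d w) = τ d)
    (hw : ∀ a ∈ A, Ψ a = 0 → inner ℂ w (rep M a w) = 0) (x : M) :
    inner ℂ w (rep M x w) = τ x := by
  have h1 : ∀ a ∈ A, inner ℂ w (rep M a w) = τ a := fun a ha => by
    have e : a = Ψ a + (a - Ψ a) := by abel
    have h2 := hw (a - Ψ a) (A.sub_mem ha (mem_starDiagonal.1 (h.map_mem a)).1) (by
      rw [map_sub, h.map_eq_self (h.map_mem a), sub_self])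
    rw [e, map_add, add_apply, inner_add_right, h2, hD _ (h.map_mem a),
      map_add, map_sub, h.trace_eq]
    ring
  refine eq_of_weakStar_dense hA (weakStarContinuous_vecFun w w) (g := τ.toLinearMap) τ.normal h1
    (fun a ha => ?_) x
  rw [vecFun_apply, ← inner_rep_left, ← inner_conj_symm, h1 a ha, map_star]
  rfl

theorem aInfty_le (hA : IsNoncommutativeHInfty τ A)
    (h : IsTraceExpectation τ (starDiagonal A) Ψ) : aInfty τ A ≤ A := by
  intro b hb
  by_contra hbA
  have hmul : ∀ x ∈ A, ∀ y ∈ A, Ψ (x * y) = Ψ x * Ψ y := fun x hx y hy =>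
    expectation_map_mul hA.tracial.exists_projection h (subset_AInfty hx) (subset_AInfty hy)
  have hDA : ∀ d ∈ starDiagonal A, d ∈ A := fun d hd => (mem_starDiagonal.1 hd).1
  obtain ⟨ξ₀, η, hξ₀, hb₀⟩ := exists_vecFun_separating A.toSubmodule
    hA.tracial.weakStar_closed hbA
  obtain ⟨ζ₀, hζ₀⟩ := exists_dominating_vector τ
  obtain ⟨ζ, ξ, hdom, hξ, hbne⟩ : ∃ ζ ξ : Ampl H, (∀ x : M, ‖toL2 τ x‖ ≤ ‖rep M x ζ‖) ∧
      (∀ a ∈ A, inner ℂ (rep M a ζ) ξ = 0) ∧ inner ℂ (rep M b ζ) ξ ≠ 0 := by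
    -- Adjoining ζ₀ to η makes the vector dominating; pairing it with 0 leaves the separating
    -- functional unchanged.
    have e : ∀ x, inner ℂ (rep M x (interleave η ζ₀)) (interleave ξ₀ 0) = inner ℂ (rep M x η) ξ₀ :=
      fun x => by rw [rep_interleave, inner_interleave, inner_zero_right, add_zero]
    refine ⟨interleave η ζ₀, interleave ξ₀ 0, fun x => (hζ₀ x).trans ?_, fun a ha => ?_, ?_⟩
    · refine le_of_sq_le_sq ?_ (norm_nonneg _)
      have h1 : ‖rep M x (interleave η ζ₀)‖ ^ 2 = ‖rep M x η‖ ^ 2 + ‖rep M x ζ₀‖ ^ 2 := by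
        rw [rep_interleave, @norm_sq_eq_re_inner ℂ, inner_interleave, map_add,
          ← @norm_sq_eq_re_inner ℂ, ← @norm_sq_eq_re_inner ℂ]
      rw [h1]
      exact le_add_of_nonneg_left (sq_nonneg _)
    · rw [e, ← inner_conj_symm, hξ₀ a ha, map_zero]
    · rw [e, ← inner_conj_symm]
      exact (map_ne_zero _).2 hb₀
  -- `A₀` is the kernel of the expectation in `A`, and `ζ - p` is the wandering part of `ζ`
  let A₀ : Submodule ℂ M := A.toSubmodule ⊓ Ψ.ker
  have hA₀ : ∀ x, x ∈ A₀ ↔ x ∈ A ∧ Ψ x = 0 := fun x => Iff.rfl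
  have hA₀l : ∀ a ∈ A, ∀ x ∈ A₀, a * x ∈ A₀ := fun a ha x hx => (hA₀ _).2
    ⟨A.mul_mem ha hx.1, by rw [hmul a ha x hx.1, ((hA₀ x).1 hx).2, mul_zero]⟩
  have hA₀r : ∀ x ∈ A₀, ∀ a ∈ A, x * a ∈ A₀ := fun x hx a ha => (hA₀ _).2
    ⟨A.mul_mem hx.1 ha, by rw [hmul x hx.1 a ha, ((hA₀ x).1 hx).2, zero_mul]⟩
  have hsub : ∀ a ∈ A, a - Ψ a ∈ A₀ := fun a ha => (hA₀ _).2
    ⟨A.sub_mem ha (hDA _ (h.map_mem a)), by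
      rw [map_sub, h.map_eq_self (h.map_mem a), sub_self]⟩
  obtain ⟨p, hp, hpζ⟩ := exists_orbit_decomposition A₀ ζ ζ
  obtain ⟨a, ha, hlim⟩ := exists_seq_of_mem_closure_orbit hp
  have hqA : ζ - p ∈ (orbit A.toSubmodule ζ).topologicalClosure := by
    refine sub_mem ?_ (closure_orbit_le (N := A₀) (fun x hx =>
      rep_mem_closure_orbit_self (N := A.toSubmodule) ζ ((hA₀ x).1 hx).1) hp)
    simpa using rep_mem_closure_orbit_self (N := A.toSubmodule) ζ A.one_mem
  -- Approximate p by aζ with a ∈ A₀: since Ψ(d − da) = d, contractivity gives ‖d‖₂ ≤ ‖d − da‖₂ ≤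
  -- ‖(d − da)ζ‖.
  have hqdom : ∀ d ∈ starDiagonal A, ‖toL2 τ d‖ ≤ ‖rep M d (ζ - p)‖ := fun d hd => by
    have h1 : Tendsto (fun n => rep M (d - d * a n) ζ) atTop (𝓝 (rep M d (ζ - p))) := by
      have := (((rep M d).continuous.tendsto p).comp hlim).const_sub (rep M d ζ)
      rw [← map_sub] at this
      refine this.congr fun n => ?_
      rw [map_sub, map_mul]
      rfl
    refine ge_of_tendsto' h1.norm fun n => ?_
    have h2 : Ψ (d - d * a n) = d := by
      rw [map_sub, h.map_eq_self hd, ((hA₀ _).1 (hA₀l d (hDA d hd) _ (ha n))).2, sub_zero]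
    calc ‖toL2 τ d‖ = ‖toL2 τ (Ψ (d - d * a n))‖ := by rw [h2]
      _ ≤ ‖toL2 τ (d - d * a n)‖ := h.norm_toL2_le _
      _ ≤ _ := hdom _
  obtain ⟨w, hwq, hwD, -⟩ := exists_trace_vector τ (starDiagonal A) (ζ - p) hqdom
  have hwA : w ∈ (orbit A.toSubmodule ζ).topologicalClosure :=
    closure_orbit_le (fun d hd => rep_mem_closure_orbit
      (fun x hx => A.mul_mem (hDA d hd) hx) hqA) hwq
  have hwperp : ∀ x ∈ A₀, inner ℂ (rep M x ζ) w = 0 := fun x hx => by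
    rw [← inner_conj_symm]
    rw [mem_closure_orbit_iff.1 hwq _ fun d hd => ?_, map_zero]
    rw [← inner_conj_symm, ← inner_rep_star_left, ← mul_apply_eq_comp, ← map_mul,
      hpζ _ (rep_mem_closure_orbit_self ζ (hA₀l _ (hDA _ ((starDiagonal A).star_mem' hd)) x hx)),
      map_zero]
  have hwperp' : ∀ x ∈ A₀, inner ℂ (rep M x w) w = 0 := fun x hx =>
    mem_closure_orbit_iff.1 (rep_mem_closure_orbit (hA₀r x hx) hwA) w hwperp
  have hw : ∀ x, inner ℂ w (rep M x w) = τ x :=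
    trace_vector_of_wandering hA.weakStar_dense h hwD fun x hx hx0 => by
      rw [← inner_conj_symm, hwperp' x ⟨hx, hx0⟩, map_zero]
  -- `ζ` is in the closure of `M w`
  obtain ⟨t, -, ht, hζt⟩ := exists_trace_vector τ ⊤ ζ fun x _ => hdom x
  replace ht : ∀ x, inner ℂ t (rep M x t) = τ x := fun x => ht x trivial
  replace hζt : ζ ∈ (orbit (⊤ : Submodule ℂ M) t).topologicalClosure := hζt
  have hwt : w ∈ (orbit (⊤ : Submodule ℂ M) t).topologicalClosure :=
    closure_orbit_le (fun x _ => rep_mem_closure_orbit (N' := ⊤) (fun _ _ => trivial) hζt) hwA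
  have hζM : ζ ∈ (orbit (⊤ : Submodule ℂ M) w).topologicalClosure :=
    closure_orbit_le (fun x _ => rep_mem_closure_orbit (N' := ⊤) (fun _ _ => trivial)
      (mem_closure_orbit_symm ht hw hwt)) hζt
  -- `ζ` is in the closure of `A w`
  have hζA : ζ ∈ (orbit A.toSubmodule w).topologicalClosure := by
    obtain ⟨r, hr, hrζ⟩ := exists_orbit_decomposition A.toSubmodule w ζ
    have h1 : ∀ x ∈ A, inner ℂ (rep M x w) (ζ - r) = 0 := fun x hx =>
      hrζ _ (rep_mem_closure_orbit_self w hx)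
    -- Both terms vanish: ⟨x*w, ζ⟩ = ⟨w, xζ⟩ with w ⊥ A₀ζ, and ⟨x*w, yw⟩ = ⟨w, xyw⟩ with xy ∈ A₀ for
    -- y ∈ A.
    have h2 : ∀ x ∈ A₀, inner ℂ (rep M (star x) w) (ζ - r) = 0 := fun x hx => by
      have h3 : inner ℂ r (rep M (star x) w) = 0 := by
        refine mem_closure_orbit_iff.1 hr _ fun y hy => ?_
        rw [← inner_rep_left, ← mul_apply_eq_comp, ← map_mul]
        exact hwperp' _ (hA₀r x hx y hy)
      rw [inner_sub_right, inner_rep_star_left, ← inner_conj_symm, hwperp x hx,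
        ← inner_conj_symm _ r, h3, sub_self]
    have h3 : ∀ x ∈ A, inner ℂ (rep M (star x) w) (ζ - r) = 0 := fun x hx => by
      have e : star x = star (Ψ x) + star (x - Ψ x) := by rw [← star_add]; congr 1; abel
      rw [e, map_add, add_apply, inner_add_left, h2 _ (hsub x hx),
        h1 _ (mem_starDiagonal.1 (h.map_mem x)).2, add_zero]
    have h4 : ∀ x, inner ℂ (ζ - r) (rep M x w) = 0 := fun x =>
      eq_of_weakStar_dense hA.weakStar_dense (f := vecFun M (ζ - r) w) (g := 0)
        (weakStarContinuous_vecFun _ _)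
        (let _ := weakStarTopology M; (continuous_const : Continuous fun _ : M => (0 : ℂ)))
        (fun x hx => by
          rw [vecFun_apply, ← inner_conj_symm, h1 x hx, map_zero, LinearMap.zero_apply])
        (fun x hx => by
          rw [vecFun_apply, ← inner_conj_symm, h3 x hx, map_zero, LinearMap.zero_apply]) x
    have h5 : ζ - r ∈ (orbit (⊤ : Submodule ℂ M) w).topologicalClosure :=
      sub_mem hζM (closure_orbit_le (fun x _ =>
        rep_mem_closure_orbit_self (N := ⊤) w trivial) hr)
    have h6 : inner ℂ (ζ - r) (ζ - r) = 0 := mem_closure_orbit_iff.1 h5 _ fun x _ => by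
      rw [← inner_conj_symm, h4, map_zero]
    rw [sub_eq_zero.1 (inner_self_eq_zero.1 h6)]
    exact hr
  have hξw : ∀ x ∈ A, inner ℂ (rep M x w) ξ = 0 := fun x hx =>
    mem_closure_orbit_iff.1 (rep_mem_closure_orbit (N' := A.toSubmodule)
      (fun y hy => A.mul_mem hx hy) hwA) ξ hξ
  have hξB : ∀ x ∈ aInfty τ A, inner ℂ (rep M x w) ξ = 0 := fun x hx => by
    obtain ⟨c, hc, hcx⟩ := exists_seq_of_mem_AInfty hx
    have h1 : Tendsto (fun n => rep M (c n) w) atTop (𝓝 (rep M x w)) := by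
      rw [tendsto_iff_norm_sub_tendsto_zero] at hcx ⊢
      refine hcx.congr fun n => ?_
      rw [← toL2_sub, ← norm_rep_eq_of_trace (N := ⊤) (fun x _ => hw x) trivial, map_sub]
      rfl
    refine tendsto_nhds_unique (h1.inner (tendsto_const_nhds (x := ξ))) ?_
    simp only [hξw _ (hc _)]
    exact tendsto_const_nhds
  exact hbne (mem_closure_orbit_iff.1 (rep_mem_closure_orbit (N' := (aInfty τ A).toSubmodule)
    (fun x hx => (aInfty τ A).mul_mem hb (le_aInfty hx)) hζA) ξ hξB)

end Density

end NCHardy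

open NCHardy in
theorem theorem4p4 {H : Type*} [NormedAddCommGroup H] [InnerProductSpace ℂ H] [CompleteSpace H]
    (M : VonNeumannAlgebra H) (τ : FaithfulNormalTracialState M)
    (A : Subalgebra ℂ M) (hA : IsTracialSubalgebra τ A) :
    ∃ B : Subalgebra ℂ M, (B : Set M) = AInfty τ A ∧ IsTracialSubalgebra τ B ∧
      (∃ Ψ : M →ₗ[ℂ] M,
        IsCanonicalExpectation τ A Ψ ∧ IsCanonicalExpectation τ B Ψ ∧
        (∀ Ψ' : M →ₗ[ℂ] M,
          IsCanonicalExpectation τ A Ψ' ∨ IsCanonicalExpectation τ B Ψ' → Ψ' = Ψ) ∧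
        (∀ Φ : A →ₐ[ℂ] M, IsTracialProjection τ A Φ → ∀ a : A, Φ a = Ψ a) ∧
        (∀ Φ : B →ₐ[ℂ] M, IsTracialProjection τ B Φ → ∀ b : B, Φ b = Ψ b)) ∧
      (IsNoncommutativeHInfty τ A → A = B) := by
  obtain ⟨Ψ, hΨ⟩ := exists_isTraceExpectation τ (starDiagonal A)
    (weakStar_isClosed_starDiagonal hA.weakStar_closed)
  have hdiag : starDiagonal (aInfty τ A) = starDiagonal A := by
    have := diagonal_aInfty hA.exists_projection hΨ
    ext x
    exact SetLike.ext_iff.1 this x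
  have hΨB : IsTraceExpectation τ (starDiagonal (aInfty τ A)) Ψ := by rwa [hdiag]
  refine ⟨aInfty τ A, rfl, isTracialSubalgebra_aInfty hA.exists_projection hΨ,
    ⟨Ψ, hΨ.isCanonicalExpectation hA.weakStar_closed,
      hΨB.isCanonicalExpectation weakStar_isClosed_aInfty, ?_, fun Φ hΦ => hΦ.eq_expectation hΨ,
      fun Φ hΦ => hΦ.eq_expectation hΨB⟩,
    fun hH => le_antisymm le_aInfty (aInfty_le hH hΨ)⟩
  rintro Ψ' (h | h)
  · exact hΨ.unique h.isTraceExpectation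
  · exact hΨB.unique h.isTraceExpectation
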